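/- Let $r\ge 1$ be an integer, let $a$ be an integer prime to $r$, and let $\mu_r\subset\mathbb{C}^*$ be the group of $r$-th roots of unity. Write $z_j=x_j+\sqrt{-1}\,y_j$ ($1\le j\le 4$) for the coordinates of $\mathbb{C}^4=\mathbb{R}^4\times\mathbb{R}^4$ and $z_3^r=f+\sqrt{-1}\,g$ with $f,g$ real. Let $\tilde W_{r,1}\subset\mathbb{C}^4$ be the compact $5$-dimensional submanifold given by $$x_1^2+x_2^2+f^2+x_4^2=y_1^2+y_2^2+g^2+y_4^2=1,\qquad x_1y_1+x_2y_2+fg+x_4y_4=0,$$ and let $W_{1,1}=\tilde W_{1,1}$. The generator $\xi=e^{2\pi i/r}$ of $\mu_r$ acts on $\tilde W_{r,1}$ by $$\xi\cdot(z_1,z_2,z_3,z_4)=\Big(\cos\tfrac{2\pi a}{r}\,z_1-\sin\tfrac{2\pi a}{r}\,z_2,\ \sin\tfrac{2\pi a}{r}\,z_1+\cos\tfrac{2\pi a}{r}\,z_2,\ \xi z_3,\ z_4\Big),$$ and on $W_{1,1}$ by the same formula with $\xi z_3$ replaced by $z_3$. Put $W_{r,1}=\tilde W_{r,1}/\mu_r$.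 For a manifold $X$ with a $\mu_r$-action, let $(\Omega^*_{\mu_r}(X),d)$ be the complex of $\mu_r$-invariant real-valued smooth differential forms on $X$; the cohomology of the quotient is $H^*(W_{r,1})=H^*(\Omega^*_{\mu_r}(\tilde W_{r,1}),d)$. The branched $r$-cover $$\pi_{r,w}:\tilde W_{r,1}\to W_{1,1},\qquad (z_1,z_2,z_3,z_4)\mapsto(z_1,z_2,z_3^r,z_4),$$ is $\mu_r$-equivariant. Then: (1) for every $k\ge 0$ the pullback $\pi_{r,w}^*$ induces an isomorphism of real vector spaces $$H^k(\Omega^*_{\mu_r}(W_{1,1}),d)\xrightarrow{\ \cong\ }H^k(\Omega^*_{\mu_r}(\tilde W_{r,1}),d);$$ (2) consequently $H^*(W_{r,1})\cong H^*(S^3\times S^2)$ as graded real vector spaces, where the right-hand side is de Rham cohomology; that is, $H^k(W_{r,1})\cong H^k(S^3\times S^2)$ for every $k\ge 0$. -/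

import Mathlib

noncomputable section

/-! ### Differential forms on embedded submanifolds of a normed space -/

namespace DeRham

variable {E : Type*} [NormedAddCommGroup E] [NormedSpace ℝ E]
  {F : Type*} [NormedAddCommGroup F] [NormedSpace ℝ F]
  {G : Type*} [NormedAddCommGroup G] [NormedSpace ℝ G]

/-- The tangent space at `x` of a subset `M` of a real normed space: the span of the tangent cone.
If `M` is an embedded submanifold, the tangent cone is already a linear subspace, namely the
usual tangent space `T_x M ⊆ E`. -/
def tangentSpace (M : Set E) (x : E) : Submodule ℝ E :=
  Submodule.span ℝ (tangentConeAt ℝ M x)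

/-- A not necessarily smooth real-valued differential `k`-form on `M`: an alternating `k`-linear
form on every tangent space of `M`. -/
abbrev RoughForm (M : Set E) (k : ℕ) : Type _ :=
  ∀ x : M, tangentSpace M (x : E) [⋀^Fin k]→L[ℝ] ℝ

/-- The restriction to `T_x M` of an alternating form on the ambient space. -/
def restrictAt (M : Set E) (x : E) {k : ℕ} (A : E [⋀^Fin k]→L[ℝ] ℝ) :
    tangentSpace M x [⋀^Fin k]→L[ℝ] ℝ :=
  A.compContinuousLinearMap (tangentSpace M x).subtypeL

/-- `ω'` is a smooth form on the open subset `U` of the ambient space which restricts to `ω`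
on `M ∩ U`. -/
structure IsLocalExtension {M : Set E} {k : ℕ} (ω : RoughForm M k) (U : Set E)
    (ω' : E → E [⋀^Fin k]→L[ℝ] ℝ) : Prop where
  isOpen : IsOpen U
  contDiffOn : ContDiffOn ℝ (⊤ : ℕ∞) ω' U
  eq_restrict : ∀ y : M, (y : E) ∈ U → ω y = restrictAt M y (ω' y)

theorem IsLocalExtension.mono {M : Set E} {k : ℕ} {ω : RoughForm M k} {U V : Set E}
    {ω' : E → E [⋀^Fin k]→L[ℝ] ℝ} (h : IsLocalExtension ω U ω') (hV : IsOpen V) (hVU : V ⊆ U) :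
    IsLocalExtension ω V ω' :=
  ⟨hV, h.contDiffOn.mono hVU, fun y hy => h.eq_restrict y (hVU hy)⟩

theorem IsLocalExtension.add {M : Set E} {k : ℕ} {ω η : RoughForm M k} {U V : Set E}
    {ω' η' : E → E [⋀^Fin k]→L[ℝ] ℝ} (h : IsLocalExtension ω U ω')
    (h' : IsLocalExtension η V η') : IsLocalExtension (ω + η) (U ∩ V) (ω' + η') := by
  refine ⟨h.isOpen.inter h'.isOpen, ?_, ?_⟩
  · exact (h.contDiffOn.mono Set.inter_subset_left).add
      (h'.contDiffOn.mono Set.inter_subset_right)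
  · intro y hy
    rw [Pi.add_apply, h.eq_restrict y hy.1, h'.eq_restrict y hy.2]
    rfl

theorem IsLocalExtension.smul {M : Set E} {k : ℕ} {ω : RoughForm M k} {U : Set E}
    {ω' : E → E [⋀^Fin k]→L[ℝ] ℝ} (c : ℝ) (h : IsLocalExtension ω U ω') :
    IsLocalExtension (c • ω) U (c • ω') := by
  refine ⟨h.isOpen, h.contDiffOn.const_smul c, ?_⟩
  intro y hy
  rw [Pi.smul_apply, h.eq_restrict y hy]
  rfl

theorem IsLocalExtension.zero (M : Set E) (k : ℕ) :
    IsLocalExtension (0 : RoughForm M k) Set.univ (0 : E → E [⋀^Fin k]→L[ℝ] ℝ) :=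
  ⟨isOpen_univ, contDiffOn_const, fun _ _ => rfl⟩

/-- The space `Ω^k(M)` of smooth `k`-forms on `M`: those which near every point of `M` are
restrictions of smooth forms of the ambient space. -/
def smoothForms (M : Set E) (k : ℕ) : Submodule ℝ (RoughForm M k) where
  carrier := {ω | ∀ x : M, ∃ (U : Set E) (ω' : E → E [⋀^Fin k]→L[ℝ] ℝ),
    (x : E) ∈ U ∧ IsLocalExtension ω U ω'}
  add_mem' := by
    intro ω η hω hη x
    obtain ⟨U, ω', hU, h⟩ := hω x
    obtain ⟨V, η', hV, h'⟩ := hη x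
    exact ⟨U ∩ V, ω' + η', ⟨hU, hV⟩, h.add h'⟩
  zero_mem' := fun _ => ⟨Set.univ, 0, trivial, IsLocalExtension.zero M k⟩
  smul_mem' := by
    intro c ω hω x
    obtain ⟨U, ω', hU, h⟩ := hω x
    exact ⟨U, c • ω', hU, h.smul c⟩

/-- Smooth `k`-forms on `M`. -/
def Form (M : Set E) (k : ℕ) : Type _ := smoothForms M k

instance (M : Set E) (k : ℕ) : AddCommGroup (Form M k) :=
  inferInstanceAs (AddCommGroup (smoothForms M k))

instance (M : Set E) (k : ℕ) : Module ℝ (Form M k) :=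
  inferInstanceAs (Module ℝ (smoothForms M k))

/-- `η = dω` on `M`: at every point of `M`, the form `η` is the restriction of the exterior
derivative of an ambient smooth local extension of `ω`. (On an embedded submanifold the value of
`dω` does not depend on the extension.) -/
def IsExtDeriv {M : Set E} {k : ℕ} (ω : Form M k) (η : Form M (k + 1)) : Prop :=
  ∀ x : M, ∃ (U : Set E) (ω' : E → E [⋀^Fin k]→L[ℝ] ℝ), (x : E) ∈ U ∧
    IsLocalExtension ω.1 U ω' ∧ η.1 x = restrictAt M x (extDeriv ω' x)

/-- The exterior derivative `d : Ω^k(M) → Ω^{k+1}(M)`, given by its graph. -/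
def extDerivGraph (M : Set E) (k : ℕ) : Submodule ℝ (Form M k × Form M (k + 1)) where
  carrier := {p | IsExtDeriv p.1 p.2}
  add_mem' := by
    intro p q hp hq x
    obtain ⟨U, ω', hU, h, e⟩ := hp x
    obtain ⟨V, η', hV, h', e'⟩ := hq x
    refine ⟨U ∩ V, ω' + η', ⟨hU, hV⟩, h.add h', ?_⟩
    rw [extDeriv_add]
    · change p.2.1 x + q.2.1 x = _
      rw [e, e']
      rfl
    · exact (h.contDiffOn.contDiffAt (h.isOpen.mem_nhds hU)).differentiableAt (by simp)
    · exact (h'.contDiffOn.contDiffAt (h'.isOpen.mem_nhds hV)).differentiableAt (by simp)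
  zero_mem' := by
    intro x
    refine ⟨Set.univ, 0, trivial, IsLocalExtension.zero M k, ?_⟩
    have : extDeriv (0 : E → E [⋀^Fin k]→L[ℝ] ℝ) x = 0 := by
      have := extDeriv_smul (x := (x : E)) (0 : ℝ) (0 : E → E [⋀^Fin k]→L[ℝ] ℝ)
      rwa [zero_smul, zero_smul] at this
    rw [this]
    rfl
  smul_mem' := by
    intro c p hp x
    obtain ⟨U, ω', hU, h, e⟩ := hp x
    refine ⟨U, c • ω', hU, h.smul c, ?_⟩
    rw [extDeriv_smul]
    change c • p.2.1 x = _
    rw [e]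
    rfl

/-! ### Cohomology -/

/-- The closed `k`-forms of a graded subspace `S` of the de Rham complex of `M`. -/
def closedForms {M : Set E} (S : ∀ k, Submodule ℝ (Form M k)) (k : ℕ) :
    Submodule ℝ (Form M k) :=
  S k ⊓ (extDerivGraph M k).comap (LinearMap.inl ℝ (Form M k) (Form M (k + 1)))

/-- The exact `k`-forms of a graded subspace `S` of the de Rham complex of `M`: the exterior
derivatives of the `(k-1)`-forms in `S`. -/
def exactForms {M : Set E} (S : ∀ k, Submodule ℝ (Form M k)) :
    ∀ k : ℕ, Submodule ℝ (Form M k)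
  | 0 => ⊥
  | k + 1 => (extDerivGraph M k ⊓ (S k).comap (LinearMap.fst ℝ (Form M k) (Form M (k + 1)))).map
      (LinearMap.snd ℝ (Form M k) (Form M (k + 1)))

/-- The cohomology `H^k(S, d)` of a subcomplex `S` of the de Rham complex of `M`. -/
abbrev Cohomology {M : Set E} (S : ∀ k, Submodule ℝ (Form M k)) (k : ℕ) : Type _ :=
  closedForms S k ⧸ (exactForms S k).submoduleOf (closedForms S k)

/-! ### Smooth maps and pullback -/

/-- A smooth map `M → N` given as the restriction of a smooth map of the ambient spaces. -/
structure SmoothMap (M : Set E) (N : Set F) where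
  toFun : E → F
  contDiff : ContDiff ℝ (⊤ : ℕ∞) toFun
  mapsTo : Set.MapsTo toFun M N

/-- The map of sets underlying a smooth map. -/
def SmoothMap.apply {M : Set E} {N : Set F} (φ : SmoothMap M N) (x : M) : N :=
  ⟨φ.toFun x, φ.mapsTo x.2⟩

/-- Composition of smooth maps. -/
def SmoothMap.comp {M : Set E} {N : Set F} {P : Set G} (ψ : SmoothMap N P) (φ : SmoothMap M N) :
    SmoothMap M P :=
  ⟨ψ.toFun ∘ φ.toFun, ψ.contDiff.comp φ.contDiff, ψ.mapsTo.comp φ.mapsTo⟩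

theorem SmoothMap.differentiableAt {M : Set E} {N : Set F} (φ : SmoothMap M N) (x : E) :
    DifferentiableAt ℝ φ.toFun x :=
  (φ.contDiff.differentiable (by simp)) x

theorem SmoothMap.fderiv_mem {M : Set E} {N : Set F} (φ : SmoothMap M N) (x : E)
    (v : tangentSpace M x) :
    ((fderiv ℝ φ.toFun x).comp (tangentSpace M x).subtypeL) v ∈
      tangentSpace N (φ.toFun x) := by
  have hle : tangentSpace M x ≤
      (tangentSpace N (φ.toFun x)).comap (fderiv ℝ φ.toFun x).toLinearMap := by
    refine Submodule.span_le.2 fun w hw => ?_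
    have h1 := ((φ.differentiableAt x).hasFDerivAt.hasFDerivWithinAt (s := M)).mapsTo_tangent_cone
      hw
    exact Submodule.subset_span (tangentConeAt_mono φ.mapsTo.image_subset h1)
  exact hle v.2

/-- The differential `T_x M → T_{φ(x)} N` of a smooth map. -/
def SmoothMap.tangentMap {M : Set E} {N : Set F} (φ : SmoothMap M N) (x : E) :
    tangentSpace M x →L[ℝ] tangentSpace N (φ.toFun x) :=
  ((fderiv ℝ φ.toFun x).comp (tangentSpace M x).subtypeL).codRestrict _ (φ.fderiv_mem x)

/-- Pullback of forms that need not be smooth. -/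
def SmoothMap.roughPullback {M : Set E} {N : Set F} (φ : SmoothMap M N) {k : ℕ}
    (ω : RoughForm N k) : RoughForm M k :=
  fun x => (ω (φ.apply x)).compContinuousLinearMap (φ.tangentMap x)

theorem norm_alternatization_le {k : ℕ}
    (f : ContinuousMultilinearMap ℝ (fun _ : Fin k => E) ℝ) :
    ‖ContinuousMultilinearMap.alternatization f‖ ≤ (k.factorial : ℝ) * ‖f‖ := by
  refine ContinuousAlternatingMap.opNorm_le_bound _ (by positivity) fun v => ?_
  rw [ContinuousMultilinearMap.alternatization_apply_apply]
  refine (norm_sum_le _ _).trans ?_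
  have h (σ : Equiv.Perm (Fin k)) :
      ‖Equiv.Perm.sign σ • f (v ∘ σ)‖ ≤ ‖f‖ * ∏ i, ‖v i‖ := by
    have e : ∏ i, ‖(v ∘ σ) i‖ = ∏ i, ‖v i‖ := Equiv.prod_comp σ (fun i => ‖v i‖)
    rcases Int.units_eq_one_or (Equiv.Perm.sign σ) with hs | hs <;>
      simpa [hs, ← e] using f.le_opNorm (v ∘ σ)
  refine (Finset.sum_le_sum fun σ _ => h σ).trans_eq ?_
  simp [Fintype.card_perm, mul_assoc]

theorem contDiffOn_of_toContinuousMultilinearMap {k : ℕ} {ω : E → F [⋀^Fin k]→L[ℝ] ℝ} {U : Set E}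
    (h : ContDiffOn ℝ (⊤ : ℕ∞) (fun x => (ω x).toContinuousMultilinearMap) U) : ContDiffOn ℝ (⊤ : ℕ∞) ω U := by
  let L : ContinuousMultilinearMap ℝ (fun _ : Fin k => F) ℝ →L[ℝ] F [⋀^Fin k]→L[ℝ] ℝ :=
    LinearMap.mkContinuous
      { toFun := fun f => ContinuousMultilinearMap.alternatization f
        map_add' := map_add _
        map_smul' := fun c f => by
          ext v
          simp only [ContinuousMultilinearMap.alternatization_apply_apply, Finset.smul_sum,
            smul_apply, ContinuousAlternatingMap.smul_apply,
            RingHom.id_apply]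
          exact Finset.sum_congr rfl fun σ _ => smul_comm _ _ _ }
      _ norm_alternatization_le
  have e : ω = fun x => (k.factorial : ℝ)⁻¹ • L (ω x).toContinuousMultilinearMap := by
    funext x
    ext v
    have : (L (ω x).toContinuousMultilinearMap) v = (k.factorial : ℝ) * ω x v := by
      change ContinuousMultilinearMap.alternatization (ω x).toContinuousMultilinearMap v = _
      rw [ContinuousMultilinearMap.alternatization_apply_apply]
      have h (σ : Equiv.Perm (Fin k)) : Equiv.Perm.sign σ •
          (ω x).toContinuousMultilinearMap (v ∘ σ) = ω x v := by
        have := (ω x).toAlternatingMap.map_perm v σ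
        change ω x (v ∘ σ) = Equiv.Perm.sign σ • ω x v at this
        change Equiv.Perm.sign σ • ω x (v ∘ σ) = _
        rw [this, smul_smul]
        simp
      simp only [h]
      simp [Fintype.card_perm]
    simp [this, Nat.factorial_ne_zero]
  rw [e]
  exact (L.contDiff.comp_contDiffOn h).const_smul _

theorem contDiffOn_compContinuousLinearMap {k : ℕ} {ω : E → F [⋀^Fin k]→L[ℝ] ℝ} {U : Set E} {A : E → E →L[ℝ] F}
    (h : ContDiffOn ℝ (⊤ : ℕ∞) ω U) (hA : ContDiffOn ℝ (⊤ : ℕ∞) A U) :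
    ContDiffOn ℝ (⊤ : ℕ∞) (fun x => (ω x).compContinuousLinearMap (A x)) U := by
  apply contDiffOn_of_toContinuousMultilinearMap
  have h1 : ContDiffOn ℝ (⊤ : ℕ∞) (fun x => (ω x).toContinuousMultilinearMap) U :=
    (ContinuousAlternatingMap.toContinuousMultilinearMapLI (𝕜 := ℝ) (E := F) (F := ℝ)
      (ι := Fin k)).contDiff.comp_contDiffOn h
  have h2 : ContDiffOn ℝ (⊤ : ℕ∞) (fun x => ContinuousMultilinearMap.compContinuousLinearMapContinuousMultilinear
      ℝ (fun _ : Fin k => E) (fun _ => F) ℝ (fun _ => A x)) U :=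
    (ContinuousMultilinearMap.contDiff _).comp_contDiffOn (contDiffOn_pi.2 fun _ => hA)
  exact h2.clm_apply h1

/-- Pullback of forms on the ambient spaces. -/
def ambientPullback (φ : E → F) {k : ℕ} (ω' : F → F [⋀^Fin k]→L[ℝ] ℝ) :
    E → E [⋀^Fin k]→L[ℝ] ℝ :=
  fun x => (ω' (φ x)).compContinuousLinearMap (fderiv ℝ φ x)

theorem SmoothMap.isLocalExtension {M : Set E} {N : Set F} (φ : SmoothMap M N) {k : ℕ}
    {ω : RoughForm N k} {U : Set F} {ω' : F → F [⋀^Fin k]→L[ℝ] ℝ}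
    (h : IsLocalExtension ω U ω') :
    IsLocalExtension (φ.roughPullback ω) (φ.toFun ⁻¹' U) (ambientPullback φ.toFun ω') := by
  refine ⟨h.isOpen.preimage φ.contDiff.continuous, ?_, ?_⟩
  · have h1 : ContDiffOn ℝ (⊤ : ℕ∞) (fun x => ω' (φ.toFun x)) (φ.toFun ⁻¹' U) :=
      h.contDiffOn.comp φ.contDiff.contDiffOn (fun x hx => hx)
    have h2 : ContDiff ℝ (⊤ : ℕ∞) (fderiv ℝ φ.toFun) := φ.contDiff.fderiv_right (by simp)
    exact contDiffOn_compContinuousLinearMap h1 h2.contDiffOn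
  · intro y hy
    change (ω (φ.apply y)).compContinuousLinearMap _ = _
    rw [h.eq_restrict (φ.apply y) hy]
    rfl

/-- The pullback `φ^* : Ω^k(N) → Ω^k(M)`. -/
def SmoothMap.pullback {M : Set E} {N : Set F} (φ : SmoothMap M N) (k : ℕ) :
    Form N k →ₗ[ℝ] Form M k where
  toFun ω := ⟨φ.roughPullback ω.1, fun x => by
    obtain ⟨U, ω', hU, h⟩ := ω.2 (φ.apply x)
    exact ⟨_, _, hU, φ.isLocalExtension h⟩⟩
  map_add' _ _ := rfl
  map_smul' _ _ := rfl

theorem SmoothMap.pullback_isExtDeriv {M : Set E} {N : Set F} (φ : SmoothMap M N) {k : ℕ}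
    {ω : Form N k} {η : Form N (k + 1)} (h : IsExtDeriv ω η) :
    IsExtDeriv (φ.pullback k ω) (φ.pullback (k + 1) η) := by
  intro x
  obtain ⟨U, ω', hU, hω, e⟩ := h (φ.apply x)
  refine ⟨_, _, hU, φ.isLocalExtension hω, ?_⟩
  have hd : DifferentiableAt ℝ ω' (φ.toFun x) :=
    (hω.contDiffOn.contDiffAt (hω.isOpen.mem_nhds hU)).differentiableAt (by simp)
  have := extDeriv_pullback hd (φ.contDiff.contDiffAt (x := (x : E)))
    (by
      rw [minSmoothness_of_isRCLikeNormedField]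
      exact WithTop.coe_le_coe.2 (le_top : (2 : ℕ∞) ≤ ⊤))
  unfold ambientPullback
  rw [this]
  change (η.1 (φ.apply x)).compContinuousLinearMap _ = _
  rw [e]
  rfl

theorem SmoothMap.pullback_comp {M : Set E} {N : Set F} {P : Set G} (ψ : SmoothMap N P)
    (φ : SmoothMap M N) (k : ℕ) (ω : Form P k) :
    (ψ.comp φ).pullback k ω = φ.pullback k (ψ.pullback k ω) := by
  apply Subtype.ext
  funext x
  have hT : (ψ.comp φ).tangentMap (x : E) = (ψ.tangentMap (φ.toFun x)).comp (φ.tangentMap x) := by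
    ext v
    change fderiv ℝ (ψ.toFun ∘ φ.toFun) (x : E) (v : E) =
      fderiv ℝ ψ.toFun (φ.toFun x) (fderiv ℝ φ.toFun x v)
    rw [fderiv_comp _ (ψ.differentiableAt _) (φ.differentiableAt _)]
    rfl
  change (ω.1 ((ψ.comp φ).apply x)).compContinuousLinearMap ((ψ.comp φ).tangentMap (x : E)) = _
  rw [hT]
  rfl

/-- The map `H^k(T, d) → H^k(S, d)` induced by the pullback along `φ : M → N`, for graded
subspaces `T` of `Ω^*(N)` and `S` of `Ω^*(M)` with `φ^* T ⊆ S`. -/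
def SmoothMap.cohomologyMap {M : Set E} {N : Set F} (φ : SmoothMap M N)
    (T : ∀ k, Submodule ℝ (Form N k)) (S : ∀ k, Submodule ℝ (Form M k))
    (hTS : ∀ k, ∀ ω ∈ T k, φ.pullback k ω ∈ S k) (k : ℕ) :
    Cohomology T k →ₗ[ℝ] Cohomology S k :=
  Submodule.mapQ _ _
    ((φ.pullback k).restrict (p := closedForms T k) (q := closedForms S k) (by
      rintro ω ⟨hω, hd⟩
      refine ⟨hTS k ω hω, ?_⟩
      have := φ.pullback_isExtDeriv (show IsExtDeriv ω 0 from hd)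
      rw [map_zero] at this
      exact this))
    (by
      rintro ⟨ω, hω⟩ h
      change φ.pullback k ω ∈ exactForms S k
      replace h : ω ∈ exactForms T k := h
      cases k with
      | zero =>
        have h0 : ω = 0 := h
        rw [h0, map_zero]
        exact Submodule.zero_mem _
      | succ k =>
        obtain ⟨⟨η, ω₁⟩, ⟨hd, hη⟩, rfl⟩ := h
        exact ⟨(φ.pullback k η, φ.pullback (k + 1) ω₁),
          ⟨φ.pullback_isExtDeriv hd, hTS k η hη⟩, rfl⟩)

/-- The space of forms on `M` invariant under a family of smooth maps `M → M`. -/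
def invariantForms {M : Set E} {ι : Type*} (g : ι → SmoothMap M M) (k : ℕ) :
    Submodule ℝ (Form M k) where
  carrier := {ω | ∀ i, (g i).pullback k ω = ω}
  add_mem' := by
    intro ω η hω hη i
    rw [map_add, hω i, hη i]
  zero_mem' := fun i => map_zero _
  smul_mem' := by
    intro c ω hω i
    rw [map_smul, hω i]

/-- The whole de Rham complex of `M`. -/
def allForms (M : Set E) (k : ℕ) : Submodule ℝ (Form M k) := ⊤

end DeRham

/-! ### The links of the local `r`-conifolds -/

namespace Conifold

open DeRham

/-- `ℂ⁴ = ℝ⁴ × ℝ⁴` with coordinates `z_j = x_j + i y_j`, `j = 1, …, 4` (the index of `z_j` in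
`Fin 4` is `j - 1`). -/
abbrev C4 : Type := Fin 4 → ℂ

/-- `W̃_{r,λ}`, with `f + i g = z_3 ^ r`:
`x_1² + x_2² + f² + x_4² = y_1² + y_2² + g² + y_4² = λ` and
`x_1 y_1 + x_2 y_2 + f g + x_4 y_4 = 0`. -/
def Wtilde (r : ℕ) (lam : ℝ) : Set C4 :=
  {z | (z 0).re ^ 2 + (z 1).re ^ 2 + (z 2 ^ r).re ^ 2 + (z 3).re ^ 2 = lam ∧
    (z 0).im ^ 2 + (z 1).im ^ 2 + (z 2 ^ r).im ^ 2 + (z 3).im ^ 2 = lam ∧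
    (z 0).re * (z 0).im + (z 1).re * (z 1).im + (z 2 ^ r).re * (z 2 ^ r).im +
      (z 3).re * (z 3).im = 0}

/-- For complex numbers `p` (of modulus one) and `q`: the rotation of `(z_1, z_2)` by the real
`2 × 2` rotation matrix of angle `arg p`, multiplication of `z_3` by `q`, and `z_4` fixed. -/
def rotate (p q : ℂ) (z : C4) : C4 :=
  ![p.re * z 0 - p.im * z 1, p.im * z 0 + p.re * z 1, q * z 2, z 3]

theorem contDiff_rotate (p q : ℂ) : ContDiff ℝ (⊤ : ℕ∞) (rotate p q) := by
  rw [contDiff_pi]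
  intro i
  have h (j : Fin 4) : ContDiff ℝ (⊤ : ℕ∞) (fun z : C4 => z j) := contDiff_apply ℝ ℂ j
  fin_cases i
  · exact (contDiff_const.mul (h 0)).sub (contDiff_const.mul (h 1))
  · exact (contDiff_const.mul (h 0)).add (contDiff_const.mul (h 1))
  · exact contDiff_const.mul (h 2)
  · exact h 3

theorem rotate_mem {r : ℕ} {lam : ℝ} {p q : ℂ} (hp : ‖p‖ = 1) (hq : q ^ r = 1) {z : C4}
    (hz : z ∈ Wtilde r lam) : rotate p q z ∈ Wtilde r lam := by
  have hpp : p.re ^ 2 + p.im ^ 2 = 1 := by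
    have := Complex.sq_norm p
    rw [hp, Complex.normSq_apply] at this
    nlinarith
  obtain ⟨h1, h2, h3⟩ := hz
  have hqr : (q * z 2) ^ r = z 2 ^ r := by rw [mul_pow, hq, one_mul]
  refine ⟨?_, ?_, ?_⟩
  · simp [rotate, hqr]
    linear_combination h1 + ((z 0).re ^ 2 + (z 1).re ^ 2) * hpp
  · simp [rotate, hqr]
    linear_combination h2 + ((z 0).im ^ 2 + (z 1).im ^ 2) * hpp
  · simp [rotate, hqr]
    linear_combination h3 + ((z 0).re * (z 0).im + (z 1).re * (z 1).im) * hpp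

/-- The group `μ_r` of complex `r`-th roots of unity. -/
abbrev Mu (r : ℕ) : Type := rootsOfUnity r ℂ

theorem norm_zpow_eq_one {r : ℕ} (hr : 1 ≤ r) (a : ℤ) (ζ : Mu r) :
    ‖((ζ ^ a : Mu r) : ℂˣ).val‖ = 1 := by
  have : NeZero r := ⟨by omega⟩
  exact Complex.norm_eq_one_of_mem_rootsOfUnity (ζ ^ a : Mu r).2

theorem val_pow_eq_one {r : ℕ} (ζ : Mu r) : (((ζ : ℂˣ) : ℂ)) ^ r = 1 := by
  have := (mem_rootsOfUnity r (ζ : ℂˣ)).1 ζ.2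
  rw [← Units.val_pow_eq_pow_val, this, Units.val_one]

/-- The action `μ_r(a, -a, 1, 0)` of `ζ ∈ μ_r` on `W̃_{r,λ}`: `ζ = e^{2πi/r}` rotates `(x_1, x_2)`
and `(y_1, y_2)` by `2πa/r`, multiplies `z_3` by `ζ` and fixes `z_4`. -/
def actTilde (r : ℕ) (hr : 1 ≤ r) (a : ℤ) (lam : ℝ) (ζ : Mu r) :
    SmoothMap (Wtilde r lam) (Wtilde r lam) where
  toFun := rotate ((ζ ^ a : Mu r) : ℂˣ).val (ζ : ℂˣ).val
  contDiff := contDiff_rotate _ _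
  mapsTo := fun _ hz => rotate_mem (norm_zpow_eq_one hr a ζ) (val_pow_eq_one ζ) hz

/-- The action of `ζ ∈ μ_r` on `W_{1,λ} = W̃_{1,λ}`: `ζ = e^{2πi/r}` rotates `(u_1, u_2)` and
`(v_1, v_2)` by `2πa/r` and fixes `u_3, v_3, u_4, v_4`. -/
def actBase (r : ℕ) (hr : 1 ≤ r) (a : ℤ) (lam : ℝ) (ζ : Mu r) :
    SmoothMap (Wtilde 1 lam) (Wtilde 1 lam) where
  toFun := rotate ((ζ ^ a : Mu r) : ℂˣ).val 1
  contDiff := contDiff_rotate _ _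
  mapsTo := fun _ hz => rotate_mem (norm_zpow_eq_one hr a ζ) (one_pow 1) hz

/-- The branched `r`-cover `π_{r,w} : W̃_{r,λ} → W_{1,λ}`, `z_3 ↦ z_3 ^ r`. -/
def branchedCover (r : ℕ) (lam : ℝ) : SmoothMap (Wtilde r lam) (Wtilde 1 lam) where
  toFun := fun z => ![z 0, z 1, z 2 ^ r, z 3]
  contDiff := by
    rw [contDiff_pi]
    intro i
    have h (j : Fin 4) : ContDiff ℝ (⊤ : ℕ∞) (fun z : C4 => z j) := contDiff_apply ℝ ℂ j
    fin_cases i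
    · exact h 0
    · exact h 1
    · exact (h 2).pow r
    · exact h 3
  mapsTo := by
    intro z hz
    simpa [Wtilde] using hz

/-- `Ω^*_{μ_r}(W̃_{r,1})`: the `μ_r`-invariant forms on `W̃_{r,1}`. -/
def invTilde (r : ℕ) (hr : 1 ≤ r) (a : ℤ) (k : ℕ) : Submodule ℝ (Form (Wtilde r 1) k) :=
  invariantForms (actTilde r hr a 1) k

/-- `Ω^*_{μ_r}(W_{1,1})`: the `μ_r`-invariant forms on `W_{1,1}`. -/
def invBase (r : ℕ) (hr : 1 ≤ r) (a : ℤ) (k : ℕ) : Submodule ℝ (Form (Wtilde 1 1) k) :=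
  invariantForms (actBase r hr a 1) k

/-- `π_{r,w}` is `μ_r`-equivariant. -/
theorem branchedCover_equivariant (r : ℕ) (hr : 1 ≤ r) (a : ℤ) (lam : ℝ) (ζ : Mu r) :
    (branchedCover r lam).comp (actTilde r hr a lam ζ) =
      (actBase r hr a lam ζ).comp (branchedCover r lam) := by
  have : ((branchedCover r lam).comp (actTilde r hr a lam ζ)).toFun =
      ((actBase r hr a lam ζ).comp (branchedCover r lam)).toFun := by
    funext z
    have h := val_pow_eq_one ζ
    simp [SmoothMap.comp, branchedCover, actTilde, actBase, rotate, mul_pow, h]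
  unfold SmoothMap.comp at this ⊢
  congr

/-- `π_{r,w}^*` maps `μ_r`-invariant forms to `μ_r`-invariant forms. -/
theorem branchedCover_pullback_mem (r : ℕ) (hr : 1 ≤ r) (a : ℤ) (k : ℕ)
    (ω : Form (Wtilde 1 1) k) (hω : ω ∈ invBase r hr a k) :
    (branchedCover r 1).pullback k ω ∈ invTilde r hr a k := by
  intro ζ
  rw [← SmoothMap.pullback_comp, branchedCover_equivariant, SmoothMap.pullback_comp, hω ζ]

/-- The map `π_{r,w}^* : H^k(Ω^*_{μ_r}(W_{1,1}), d) → H^k(Ω^*_{μ_r}(W̃_{r,1}), d)`. -/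
def branchedCoverCohomology (r : ℕ) (hr : 1 ≤ r) (a : ℤ) (k : ℕ) :
    Cohomology (invBase r hr a) k →ₗ[ℝ] Cohomology (invTilde r hr a) k :=
  (branchedCover r 1).cohomologyMap (invBase r hr a) (invTilde r hr a)
    (branchedCover_pullback_mem r hr a) k

/-- The real cohomology `H^k(W_{r,1})` of the quotient `W_{r,1} = W̃_{r,1} / μ_r`, that is, the
cohomology of the complex of `μ_r`-invariant forms on `W̃_{r,1}`. -/
abbrev linkCohomology (r : ℕ) (hr : 1 ≤ r) (a : ℤ) (k : ℕ) : Type :=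
  Cohomology (invTilde r hr a) k

/-- `S³ × S²` inside `ℝ⁴ × ℝ³`. -/
def sphereProduct : Set (EuclideanSpace ℝ (Fin 4) × EuclideanSpace ℝ (Fin 3)) :=
  Metric.sphere 0 1 ×ˢ Metric.sphere 0 1

end Conifold

end

/-! ### Fibre integration and the homotopy operator on `ℝ × E`. -/

noncomputable section

open Set Filter Topology MeasureTheory
open scoped ContDiff

namespace DeRham

universe u

/-! Write `π` for the branched cover `z₃ ↦ z₃ ^ r`. An inverse of `π` is multivalued, its values
being permuted by the deck group `z₃ ↦ ζ z₃`, and it is not smooth along the branch locus `z₃ = 0`.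
Both defects are removed at the level of forms. A deck-invariant form has the same pullback along
all local branches. Before taking a root, a cut-off makes the third coordinate vanish on a whole
neighbourhood of the branch locus, and a retraction brings the point back to the manifold; the
composite is smooth everywhere (`branchMap`).

The result is a transfer `T` from deck-invariant forms on the cover to forms on the base
(`exists_isTransfer`). It commutes with `d`, and both `π^* T` and `T π^*` are pullbacks along
collapsing maps homotopic to the identity (`IsTransfer.pullback_sub_mem_exactForms`,
`IsTransfer.sub_mem_exactForms`). Each deck transformation is itself isotopic to the identity,
through the circle action with weight `1` on `z₃` and weight `r` on the other coordinates, so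
averaging over the deck group does not change a cohomology class. Hence `π^*` is an isomorphism on
full de Rham cohomology. Averaging over `μ_r`, with which `π^*` commutes by equivariance, carries
the isomorphism over to invariant forms.

For the second claim, `W_{1,1}` is the manifold of orthonormal 2-frames in `ℝ⁴`, trivialized as `S³
× S²` by quaternion multiplication. On it `μ_r` acts by rotations isotopic to the identity, so its
invariant cohomology is its full cohomology.

The analysis underneath consists of homotopy invariance for closed forms
(`sub_mem_exactForms_of_homotopy`) and an explicit smooth neighbourhood retraction onto `W̃_{r,1}`
(`nbhdRetraction`). The latter also shows that `d`, defined through local extensions, does not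
depend on them. -/

theorem continuous_slice {E H : Type*} [TopologicalSpace E] [TopologicalSpace H] {U : Set E}
    {g : ℝ × E → H} (hg : ContinuousOn g (univ ×ˢ U)) {y : E} (hy : y ∈ U) :
    Continuous fun t => g (t, y) :=
  hg.comp_continuous (by fun_prop) fun _ => ⟨trivial, hy⟩

section ParametricIntegral

variable {E G : Type*} [NormedAddCommGroup E] [NormedSpace ℝ E] [FiniteDimensional ℝ E]
  [NormedAddCommGroup G] [NormedSpace ℝ G]

/-- Dominated differentiation: finite dimension makes a closed ball around `x` compact, so the
derivative in `x` is bounded on `[0, 1]` times that ball by a constant. -/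
theorem hasFDerivAt_intervalIntegral_of_contDiffOn {U : Set E} (hU : IsOpen U) {f : ℝ × E → G}
    (hf : ContDiffOn ℝ 1 f (univ ×ˢ U)) {x : E} (hx : x ∈ U) :
    HasFDerivAt (fun x => ∫ t in (0 : ℝ)..1, f (t, x))
      (∫ t in (0 : ℝ)..1, (fderiv ℝ f (t, x)).comp (ContinuousLinearMap.inr ℝ ℝ E)) x := by
  have hW : IsOpen ((univ : Set ℝ) ×ˢ U) := isOpen_univ.prod hU
  have hd (t : ℝ) (y : E) (hy : y ∈ U) : HasFDerivAt (fun z => f (t, z))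
      ((fderiv ℝ f (t, y)).comp (ContinuousLinearMap.inr ℝ ℝ E)) y := by
    have h1 : HasFDerivAt f (fderiv ℝ f (t, y)) (t, y) :=
      ((hf.contDiffAt (hW.mem_nhds ⟨trivial, hy⟩)).differentiableAt (by simp)).hasFDerivAt
    exact h1.comp y (hasFDerivAt_prodMk_right t y)
  have hc : ContinuousOn (fun p => (fderiv ℝ f p).comp (ContinuousLinearMap.inr ℝ ℝ E))
      (univ ×ˢ U) :=
    (hf.continuousOn_fderiv_of_isOpen hW le_rfl).clm_comp continuousOn_const
  obtain ⟨ε, hε, hεU⟩ := Metric.nhds_basis_closedBall.mem_iff.1 (hU.mem_nhds hx)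
  obtain ⟨C, hC⟩ := ((isCompact_Icc (a := (0 : ℝ)) (b := 1)).prod
    (isCompact_closedBall x ε)).exists_bound_of_continuousOn
    (hc.mono (prod_mono (subset_univ _) hεU))
  refine intervalIntegral.hasFDerivAt_integral_of_dominated_of_fderiv_le
    (F := fun x t => f (t, x))
    (F' := fun x t => (fderiv ℝ f (t, x)).comp (ContinuousLinearMap.inr ℝ ℝ E))
    (bound := fun _ => C) (Metric.closedBall_mem_nhds x hε) ?_ ?_ ?_ ?_ ?_ ?_
  · filter_upwards [hU.mem_nhds hx] with y hy
    exact (continuous_slice hf.continuousOn hy).aestronglyMeasurable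
  · exact (continuous_slice hf.continuousOn hx).intervalIntegrable _ _
  · exact (continuous_slice hc hx).aestronglyMeasurable
  · refine Eventually.of_forall fun t ht y hy => hC (t, y) ⟨?_, hy⟩
    rw [uIoc_of_le zero_le_one] at ht
    exact Ioc_subset_Icc_self ht
  · exact intervalIntegrable_const
  · exact Eventually.of_forall fun t _ y hy => hd t y (hεU hy)

end ParametricIntegral

/-- Each induction step replaces the integrand by its derivative, with values in `E →L[ℝ] G`. The
target therefore has to vary inside the induction, and it shares the universe of `E` so that the new
target is still admissible. -/
theorem contDiffOn_nat_intervalIntegral {E : Type u} [NormedAddCommGroup E] [NormedSpace ℝ E]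
    [FiniteDimensional ℝ E] {U : Set E} (hU : IsOpen U) (n : ℕ) :
    ∀ {G : Type u} [NormedAddCommGroup G] [NormedSpace ℝ G] [CompleteSpace G] {f : ℝ × E → G},
      ContDiffOn ℝ ∞ f (univ ×ˢ U) →
      ContDiffOn ℝ n (fun x => ∫ t in (0 : ℝ)..1, f (t, x)) U := by
  have hW : IsOpen ((univ : Set ℝ) ×ˢ U) := isOpen_univ.prod hU
  induction n with
  | zero =>
    intro G _ _ _ f hf
    refine contDiffOn_zero.2 fun x hx => ?_
    exact (hasFDerivAt_intervalIntegral_of_contDiffOn hU (hf.of_le (by simp))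
      hx).continuousAt.continuousWithinAt
  | succ n ih =>
    intro G _ _ _ f hf
    have hd (x) (hx : x ∈ U) := hasFDerivAt_intervalIntegral_of_contDiffOn hU
      (hf.of_le (by simp)) hx
    rw [Nat.cast_add, Nat.cast_one, contDiffOn_succ_iff_fderiv_of_isOpen hU]
    refine ⟨fun x hx => (hd x hx).differentiableAt.differentiableWithinAt, by simp, ?_⟩
    have hf' : ContDiffOn ℝ ∞
        (fun p => (fderiv ℝ f p).comp (ContinuousLinearMap.inr ℝ ℝ E)) (univ ×ˢ U) :=
      (hf.fderiv_of_isOpen hW (by simp)).clm_comp contDiffOn_const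
    exact (ih hf').congr fun x hx => (hd x hx).fderiv

theorem contDiffOn_intervalIntegral {E G : Type u} [NormedAddCommGroup E]
    [NormedSpace ℝ E] [FiniteDimensional ℝ E] [NormedAddCommGroup G] [NormedSpace ℝ G]
    [CompleteSpace G] {U : Set E} (hU : IsOpen U) {f : ℝ × E → G}
    (hf : ContDiffOn ℝ ∞ f (univ ×ˢ U)) :
    ContDiffOn ℝ ∞ (fun x => ∫ t in (0 : ℝ)..1, f (t, x)) U :=
  contDiffOn_infty.2 fun n => contDiffOn_nat_intervalIntegral hU n hf

theorem clm_intervalIntegral {G H : Type*} [NormedAddCommGroup G] [NormedSpace ℝ G]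
    [CompleteSpace G] [NormedAddCommGroup H] [NormedSpace ℝ H] [CompleteSpace H] (L : G →L[ℝ] H)
    {f : ℝ → G} (hf : Continuous f) :
    L (∫ t in (0 : ℝ)..1, f t) = ∫ t in (0 : ℝ)..1, L (f t) :=
  (L.intervalIntegral_comp_comm (hf.intervalIntegrable _ _)).symm

section FlatHomotopy

variable {E : Type u} [NormedAddCommGroup E] [NormedSpace ℝ E]

/-- The part without `dt` of a form on `ℝ × E` restricted to a slice. -/
def sliceCLM (E : Type u) [NormedAddCommGroup E] [NormedSpace ℝ E] (k : ℕ) :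
    ((ℝ × E) [⋀^Fin k]→L[ℝ] ℝ) →L[ℝ] (E [⋀^Fin k]→L[ℝ] ℝ) :=
  ContinuousAlternatingMap.compContinuousLinearMapCLM (ContinuousLinearMap.inr ℝ ℝ E)

/-- The contraction with `∂/∂t` of a form on `ℝ × E`, restricted to a slice. -/
def contractCLM (E : Type u) [NormedAddCommGroup E] [NormedSpace ℝ E] (k : ℕ) :
    ((ℝ × E) [⋀^Fin (k + 1)]→L[ℝ] ℝ) →L[ℝ] (E [⋀^Fin k]→L[ℝ] ℝ) :=
  (sliceCLM E k).comp ((ContinuousLinearMap.apply ℝ _ ((1, 0) : ℝ × E)).comp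
    ContinuousAlternatingMap.curryLeftLI.toContinuousLinearMap)

theorem sliceCLM_apply {k : ℕ} (A : (ℝ × E) [⋀^Fin k]→L[ℝ] ℝ) (v : Fin k → E) :
    sliceCLM E k A v = A fun i => (0, v i) := rfl

/-- The homotopy operator on forms on `ℝ × E`: integration over the fibre `[0, 1]`. -/
def fibreIntegral {k : ℕ} (β : ℝ × E → (ℝ × E) [⋀^Fin (k + 1)]→L[ℝ] ℝ) (x : E) :
    E [⋀^Fin k]→L[ℝ] ℝ :=
  ∫ t in (0 : ℝ)..1, contractCLM E k (β (t, x))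

theorem contDiffOn_fibreIntegral [FiniteDimensional ℝ E] {k : ℕ} {U : Set E} (hU : IsOpen U)
    {β : ℝ × E → (ℝ × E) [⋀^Fin (k + 1)]→L[ℝ] ℝ} (hβ : ContDiffOn ℝ ∞ β (univ ×ˢ U)) :
    ContDiffOn ℝ ∞ (fibreIntegral β) U :=
  contDiffOn_intervalIntegral hU ((contractCLM E k).contDiff.comp_contDiffOn hβ)

theorem hasDerivAt_slice_of_closed {k : ℕ} {β : ℝ × E → (ℝ × E) [⋀^Fin k]→L[ℝ] ℝ}
    {t : ℝ} {x : E} (hd : DifferentiableAt ℝ β (t, x)) :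
    HasDerivAt (fun t => sliceCLM E k (β (t, x)))
      (sliceCLM E k (fderiv ℝ β (t, x) (1, 0))) t := by
  have h1 : HasDerivAt (fun t : ℝ => (t, x)) ((1 : ℝ), (0 : E)) t :=
    (hasDerivAt_id t).prodMk (hasDerivAt_const t x)
  have h2 := hd.hasFDerivAt.comp_hasDerivAt t h1
  exact (sliceCLM E k).hasFDerivAt.comp_hasDerivAt t h2

/-- Cartan's formula for a closed form: in `dβ (∂_t, v₀, …, v_k) = 0` the first summand is `∂_t β`
on the slice, and the remaining ones make up minus the exterior derivative of the contraction. -/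
theorem alternatizeUncurryFin_contract_of_closed {k : ℕ}
    {β : ℝ × E → (ℝ × E) [⋀^Fin (k + 1)]→L[ℝ] ℝ} {p : ℝ × E} (hc : extDeriv β p = 0) :
    ContinuousAlternatingMap.alternatizeUncurryFin
      (((contractCLM E k).comp (fderiv ℝ β p)).comp (ContinuousLinearMap.inr ℝ ℝ E)) =
      sliceCLM E (k + 1) (fderiv ℝ β p (1, 0)) := by
  ext v
  have h := congrArg (fun A => A (Fin.cons ((1 : ℝ), (0 : E)) fun i => ((0 : ℝ), v i))) hc
  simp only [extDeriv, ContinuousAlternatingMap.alternatizeUncurryFin_apply] at h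
  rw [Fin.sum_univ_succ] at h
  rw [ContinuousAlternatingMap.alternatizeUncurryFin_apply, sliceCLM_apply]
  simp only [Fin.val_zero, pow_zero, one_smul, Fin.cons_zero, Fin.removeNth_zero, Fin.tail_cons,
    Fin.cons_succ, Fin.val_succ, pow_succ, mul_neg, mul_one, neg_smul, Finset.sum_neg_distrib] at h
  replace h := add_neg_eq_zero.1 (h.trans rfl)
  refine Eq.trans (Finset.sum_congr rfl fun i _ => ?_) h.symm
  congr 1
  change fderiv ℝ β p (0, v i) (Fin.cons (1, 0) fun j => (0, i.removeNth v j)) = _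
  congr 1
  funext j
  refine Fin.cases ?_ (fun j => ?_) j
  · simp [Fin.removeNth]
  · simp [Fin.removeNth]

/-- Differentiation under the integral and Cartan's formula give `∫ ∂_t β dt`, which the fundamental
theorem of calculus evaluates. Closedness removes the second term of the usual homotopy formula. -/
theorem extDeriv_fibreIntegral [FiniteDimensional ℝ E] {k : ℕ} {U : Set E} (hU : IsOpen U)
    {β : ℝ × E → (ℝ × E) [⋀^Fin (k + 1)]→L[ℝ] ℝ} (hβ : ContDiffOn ℝ ∞ β (univ ×ˢ U))
    {x : E} (hx : x ∈ U) (hc : ∀ t, extDeriv β (t, x) = 0) :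
    extDeriv (fibreIntegral β) x =
      sliceCLM E (k + 1) (β (1, x)) - sliceCLM E (k + 1) (β (0, x)) := by
  have hW : IsOpen ((univ : Set ℝ) ×ˢ U) := isOpen_univ.prod hU
  have hd (t : ℝ) : DifferentiableAt ℝ β (t, x) :=
    (hβ.contDiffAt (hW.mem_nhds ⟨trivial, hx⟩)).differentiableAt (by simp)
  have hf : ContDiffOn ℝ ∞ (fun p => contractCLM E k (β p)) (univ ×ˢ U) :=
    (contractCLM E k).contDiff.comp_contDiffOn hβ
  have hf' (t : ℝ) : fderiv ℝ (fun p => contractCLM E k (β p)) (t, x) =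
      (contractCLM E k).comp (fderiv ℝ β (t, x)) :=
    ((contractCLM E k).hasFDerivAt.comp _ (hd t).hasFDerivAt).fderiv
  have h1 := hasFDerivAt_intervalIntegral_of_contDiffOn hU (hf.of_le (by simp)) hx
  have hcd : ContinuousOn (fderiv ℝ β) (univ ×ˢ U) :=
    hβ.continuousOn_fderiv_of_isOpen hW (by simp)
  have hcont : Continuous fun t => fderiv ℝ β (t, x) := continuous_slice hcd hx
  have hcc : Continuous fun t =>
      ((contractCLM E k).comp (fderiv ℝ β (t, x))).comp (ContinuousLinearMap.inr ℝ ℝ E) :=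
    (continuous_const.clm_comp hcont).clm_comp continuous_const
  have h1' : fderiv ℝ (fibreIntegral β) x = ∫ t in (0 : ℝ)..1,
      ((contractCLM E k).comp (fderiv ℝ β (t, x))).comp (ContinuousLinearMap.inr ℝ ℝ E) := by
    simp only [← hf']
    exact h1.fderiv
  have h2 : extDeriv (fibreIntegral β) x = ∫ t in (0 : ℝ)..1,
      sliceCLM E (k + 1) (fderiv ℝ β (t, x) (1, 0)) := by
    simp only [← alternatizeUncurryFin_contract_of_closed (hc _)]
    have := clm_intervalIntegral (G := E →L[ℝ] E [⋀^Fin k]→L[ℝ] ℝ) (H := E [⋀^Fin (k + 1)]→L[ℝ] ℝ)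
      (ContinuousAlternatingMap.alternatizeUncurryFinCLM ℝ E ℝ) hcc
    rw [← h1'] at this
    exact this
  rw [h2]
  refine intervalIntegral.integral_eq_sub_of_hasDerivAt
    (f := fun t => sliceCLM E (k + 1) (β (t, x)))
    (fun t _ => hasDerivAt_slice_of_closed (hd t)) ?_
  exact ((sliceCLM E (k + 1)).continuous.comp
    (hcont.clm_apply continuous_const)).intervalIntegrable _ _

/-- In degree `0` there is nothing to contract; a closed function simply has zero derivative in `t`.
-/
theorem slice_eq_of_closed_zeroForm {U : Set E} (hU : IsOpen U)
    {β : ℝ × E → (ℝ × E) [⋀^Fin 0]→L[ℝ] ℝ} (hβ : ContDiffOn ℝ ∞ β (univ ×ˢ U))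
    {x : E} (hx : x ∈ U) (hc : ∀ t, extDeriv β (t, x) = 0) :
    sliceCLM E 0 (β (1, x)) = sliceCLM E 0 (β (0, x)) := by
  have hW : IsOpen ((univ : Set ℝ) ×ˢ U) := isOpen_univ.prod hU
  have hd (t : ℝ) : DifferentiableAt ℝ β (t, x) :=
    (hβ.contDiffAt (hW.mem_nhds ⟨trivial, hx⟩)).differentiableAt (by simp)
  refine is_const_of_deriv_eq_zero (f := fun t => sliceCLM E 0 (β (t, x)))
    (fun t => (hasDerivAt_slice_of_closed (hd t)).differentiableAt) (fun t => ?_) 1 0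
  rw [(hasDerivAt_slice_of_closed (hd t)).deriv]
  ext v
  have h := congrArg (fun A => A fun _ => ((1 : ℝ), (0 : E))) (hc t)
  simp only [extDeriv, ContinuousAlternatingMap.alternatizeUncurryFin_apply] at h
  simp only [Nat.reduceAdd, Finset.univ_unique, Fin.default_eq_zero, Fin.isValue,
    Finset.sum_singleton, Fin.val_zero, pow_zero, one_smul] at h
  refine Eq.trans ?_ h
  rw [sliceCLM_apply]
  congr 1
  exact Subsingleton.elim _ _

end FlatHomotopy

end DeRham
end

/-! ### Neighbourhood retractions, extension of forms, and pullback along local maps. -/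

noncomputable section

open Set Filter Topology

namespace DeRham

variable {E : Type*} [NormedAddCommGroup E] [NormedSpace ℝ E]
  {F : Type*} [NormedAddCommGroup F] [NormedSpace ℝ F]
  {G : Type*} [NormedAddCommGroup G] [NormedSpace ℝ G]

/-- A smooth retraction of an open neighbourhood onto `M`. -/
structure NbhdRetraction (M : Set E) where
  domain : Set E
  toFun : E → E
  isOpen : IsOpen domain
  subset : M ⊆ domain
  contDiffOn : ContDiffOn ℝ (⊤ : ℕ∞) toFun domain
  mapsTo : MapsTo toFun domain M
  eq_self : ∀ x ∈ M, toFun x = x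

/-- `f` is smooth on a neighbourhood of `x` in the ambient space and maps `M` to `N` there. -/
def IsSmoothAt (M : Set E) (N : Set F) (f : E → F) (x : E) : Prop :=
  ∃ O, IsOpen O ∧ x ∈ O ∧ ContDiffOn ℝ (⊤ : ℕ∞) f O ∧ MapsTo f (M ∩ O) N

theorem IsSmoothAt.differentiableAt {M : Set E} {N : Set F} {f : E → F} {x : E}
    (h : IsSmoothAt M N f x) : DifferentiableAt ℝ f x := by
  obtain ⟨O, hO, hx, hf, -⟩ := h
  exact (hf.contDiffAt (hO.mem_nhds hx)).differentiableAt (by simp)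

theorem IsSmoothAt.mapsTo {M : Set E} {N : Set F} {f : E → F} {x : E}
    (h : IsSmoothAt M N f x) (hx : x ∈ M) : f x ∈ N := by
  obtain ⟨O, hO, hxO, hf, hm⟩ := h
  exact hm ⟨hx, hxO⟩

theorem IsSmoothAt.fderiv_mem {M : Set E} {N : Set F} {f : E → F} {x : E}
    (h : IsSmoothAt M N f x) {v : E} (hv : v ∈ tangentSpace M x) :
    fderiv ℝ f x v ∈ tangentSpace N (f x) := by
  have hd := h.differentiableAt
  obtain ⟨O, hO, hx, -, hm⟩ := h
  have hle : tangentSpace M x ≤ (tangentSpace N (f x)).comap (fderiv ℝ f x).toLinearMap := by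
    refine Submodule.span_le.2 fun w hw => ?_
    rw [← tangentConeAt_inter_nhds (hO.mem_nhds hx)] at hw
    have h1 := (hd.hasFDerivAt.hasFDerivWithinAt (s := M ∩ O)).mapsTo_tangent_cone hw
    exact Submodule.subset_span (tangentConeAt_mono hm.image_subset h1)
  exact hle hv

theorem SmoothMap.isSmoothAt {M : Set E} {N : Set F} (φ : SmoothMap M N) (x : E) :
    IsSmoothAt M N φ.toFun x :=
  ⟨univ, isOpen_univ, trivial, φ.contDiff.contDiffOn, φ.mapsTo.mono_left inter_subset_left⟩

theorem SmoothMap.comp_isSmoothAt {M : Set E} {N : Set F} {P : Set G} (φ : SmoothMap N P)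
    {f : E → F} {x : E} (hf : IsSmoothAt M N f x) : IsSmoothAt M P (φ.toFun ∘ f) x := by
  obtain ⟨O, hO, hx, hc, hm⟩ := hf
  exact ⟨O, hO, hx, φ.contDiff.comp_contDiffOn hc, φ.mapsTo.comp hm⟩

theorem IsSmoothAt.comp_smoothMap {M : Set E} {N : Set F} {P : Set G} {φ : SmoothMap M N}
    {f : F → G} {x : E} (hf : IsSmoothAt N P f (φ.toFun x)) :
    IsSmoothAt M P (f ∘ φ.toFun) x := by
  obtain ⟨O, hO, hx, hc, hm⟩ := hf
  exact ⟨φ.toFun ⁻¹' O, hO.preimage φ.contDiff.continuous, hx,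
    hc.comp φ.contDiff.contDiffOn fun _ h => h, fun y hy => hm ⟨φ.mapsTo hy.1, hy.2⟩⟩

/-- The derivative within `M` is unique on the tangent cone, and by linearity on its span. -/
theorem fderiv_eq_of_eventuallyEq {M : Set E} {f g : E → F} {x : E} (hx : x ∈ M)
    (hf : DifferentiableAt ℝ f x) (hg : DifferentiableAt ℝ g x) (h : f =ᶠ[𝓝[M] x] g) {v : E}
    (hv : v ∈ tangentSpace M x) : fderiv ℝ f x v = fderiv ℝ g x v := by
  have h1 : HasFDerivWithinAt f (fderiv ℝ g x) M x :=
    (hg.hasFDerivAt.hasFDerivWithinAt).congr_of_eventuallyEq h (h.self_of_nhdsWithin hx)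
  have h2 := (hf.hasFDerivAt.hasFDerivWithinAt (s := M)).unique_on h1
  exact LinearMap.eqOn_span (f := (fderiv ℝ f x).toLinearMap) (g := (fderiv ℝ g x).toLinearMap)
    h2 hv

theorem restrictAt_ext {M : Set E} {x : E} {k : ℕ} {A B : E [⋀^Fin k]→L[ℝ] ℝ}
    (h : ∀ v : Fin k → E, (∀ i, v i ∈ tangentSpace M x) → A v = B v) :
    restrictAt M x A = restrictAt M x B := by
  ext v
  exact h _ fun i => (v i).2

theorem apply_eq_of_restrictAt_eq {M : Set E} {x : E} {k : ℕ} {A B : E [⋀^Fin k]→L[ℝ] ℝ}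
    (h : restrictAt M x A = restrictAt M x B) {v : Fin k → E}
    (hv : ∀ i, v i ∈ tangentSpace M x) : A v = B v :=
  congrArg (fun C => C fun i => (⟨v i, hv i⟩ : tangentSpace M x)) h

theorem restrictAt_sub_eq_zero_iff {M : Set E} {x : E} {k : ℕ} {A B : E [⋀^Fin k]→L[ℝ] ℝ} :
    restrictAt M x (A + (-1 : ℝ) • B) = 0 ↔ restrictAt M x A = restrictAt M x B := by
  constructor
  · intro h
    refine restrictAt_ext fun v hv => ?_
    have h' : A v + -1 * B v = 0 := apply_eq_of_restrictAt_eq (B := 0) h hv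
    linarith
  · intro h
    refine restrictAt_ext (B := 0) fun v hv => ?_
    have h' : A v = B v := apply_eq_of_restrictAt_eq h hv
    change A v + -1 * B v = 0
    linarith

theorem restrictAt_ambientPullback_congr_form {M : Set E} {N : Set F} {f : E → F} {x : E}
    (hf : IsSmoothAt M N f x) {k : ℕ} {α β : F → F [⋀^Fin k]→L[ℝ] ℝ}
    (h : restrictAt N (f x) (α (f x)) = restrictAt N (f x) (β (f x))) :
    restrictAt M x (ambientPullback f α x) = restrictAt M x (ambientPullback f β x) :=
  restrictAt_ext fun _ hv => apply_eq_of_restrictAt_eq h fun i => hf.fderiv_mem (hv i)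

theorem restrictAt_ambientPullback_congr_map {M : Set E} {f g : E → F} {x : E} (hx : x ∈ M)
    (hf : DifferentiableAt ℝ f x) (hg : DifferentiableAt ℝ g x) (h : f =ᶠ[𝓝[M] x] g) {k : ℕ}
    (α : F → F [⋀^Fin k]→L[ℝ] ℝ) :
    restrictAt M x (ambientPullback f α x) = restrictAt M x (ambientPullback g α x) := by
  refine restrictAt_ext fun v hv => ?_
  change α (f x) (fun i => fderiv ℝ f x (v i)) = α (g x) (fun i => fderiv ℝ g x (v i))
  simp only [h.self_of_nhdsWithin hx, fderiv_eq_of_eventuallyEq hx hf hg h (hv _)]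

theorem ambientPullback_comp {f : E → F} {g : F → G} {x : E} (hf : DifferentiableAt ℝ f x)
    (hg : DifferentiableAt ℝ g (f x)) {k : ℕ} (α : G → G [⋀^Fin k]→L[ℝ] ℝ) :
    ambientPullback (g ∘ f) α x = ambientPullback f (ambientPullback g α) x := by
  unfold ambientPullback
  rw [fderiv_comp x hg hf]
  rfl

theorem contDiffOn_ambientPullback {f : E → F} {O : Set E} {U : Set F} (hO : IsOpen O)
    (hf : ContDiffOn ℝ (⊤ : ℕ∞) f O) {k : ℕ} {α : F → F [⋀^Fin k]→L[ℝ] ℝ} (hα : ContDiffOn ℝ (⊤ : ℕ∞) α U) :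
    ContDiffOn ℝ (⊤ : ℕ∞) (ambientPullback f α) (O ∩ f ⁻¹' U) :=
  contDiffOn_compContinuousLinearMap (hα.comp (hf.mono inter_subset_left) fun _ h => h.2)
    ((hf.fderiv_of_isOpen hO (by simp)).mono inter_subset_left)

theorem extDeriv_ambientPullback {f : E → F} {O : Set E} {U : Set F} (hO : IsOpen O)
    (hf : ContDiffOn ℝ (⊤ : ℕ∞) f O) (hU : IsOpen U) {k : ℕ} {α : F → F [⋀^Fin k]→L[ℝ] ℝ}
    (hα : ContDiffOn ℝ (⊤ : ℕ∞) α U) {x : E} (hx : x ∈ O) (hfx : f x ∈ U) :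
    extDeriv (ambientPullback f α) x = ambientPullback f (extDeriv α) x := by
  refine extDeriv_pullback ((hα.contDiffAt (hU.mem_nhds hfx)).differentiableAt (by simp))
    (hf.contDiffAt (hO.mem_nhds hx)) ?_
  rw [minSmoothness_of_isRCLikeNormedField]
  exact WithTop.coe_le_coe.2 (le_top : (2 : ℕ∞) ≤ ⊤)

namespace NbhdRetraction

variable {M : Set E} (ρ : NbhdRetraction M)

theorem isSmoothAt {S : Set E} {x : E} (hx : x ∈ ρ.domain) : IsSmoothAt S M ρ.toFun x :=
  ⟨ρ.domain, ρ.isOpen, hx, ρ.contDiffOn, ρ.mapsTo.mono_left inter_subset_right⟩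

/-- No condition on `v` is needed because the retraction sends an open set into `M`. Consequently
its pullback kills, on the whole neighbourhood, any form that restricts to zero on `M`. -/
theorem fderiv_mem {x : E} (hx : x ∈ ρ.domain) (v : E) :
    fderiv ℝ ρ.toFun x v ∈ tangentSpace M (ρ.toFun x) :=
  (ρ.isSmoothAt (S := univ) hx).fderiv_mem
    (by simp [tangentSpace])

theorem restrictAt_ambientPullback {x : E} (hx : x ∈ M) {k : ℕ}
    (α : E → E [⋀^Fin k]→L[ℝ] ℝ) :
    restrictAt M x (ambientPullback ρ.toFun α x) = restrictAt M x (α x) := by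
  rw [restrictAt_ambientPullback_congr_map (g := id) hx
    (ρ.isSmoothAt (S := M) (ρ.subset hx)).differentiableAt differentiableAt_id]
  · unfold ambientPullback
    rw [fderiv_id]
    rfl
  · filter_upwards [self_mem_nhdsWithin] with y hy using ρ.eq_self y hy

open Classical in
/-- The pullback of a form on `M` along the retraction. -/
def extension {k : ℕ} (ω : Form M k) (y : E) : E [⋀^Fin k]→L[ℝ] ℝ :=
  if h : y ∈ ρ.domain then
    (ω.1 ⟨ρ.toFun y, ρ.mapsTo h⟩).compContinuousLinearMap
      ((fderiv ℝ ρ.toFun y).codRestrict _ (ρ.fderiv_mem h))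
  else 0

theorem extension_eq {k : ℕ} {ω : Form M k} {U : Set E} {α : E → E [⋀^Fin k]→L[ℝ] ℝ}
    (hα : IsLocalExtension ω.1 U α) {y : E} (hy : y ∈ ρ.domain) (hU : ρ.toFun y ∈ U) :
    ρ.extension ω y = ambientPullback ρ.toFun α y := by
  rw [extension, dif_pos hy, hα.eq_restrict ⟨ρ.toFun y, ρ.mapsTo hy⟩ hU]
  rfl

theorem isLocalExtension {k : ℕ} (ω : Form M k) :
    IsLocalExtension ω.1 ρ.domain (ρ.extension ω) := by
  refine ⟨ρ.isOpen, fun y hy => ?_, fun y _ => ?_⟩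
  · obtain ⟨U, α, hU, hα⟩ := ω.2 ⟨ρ.toFun y, ρ.mapsTo hy⟩
    have hO : IsOpen (ρ.domain ∩ ρ.toFun ⁻¹' U) :=
      ρ.contDiffOn.continuousOn.isOpen_inter_preimage ρ.isOpen hα.isOpen
    have h1 := (contDiffOn_ambientPullback ρ.isOpen ρ.contDiffOn hα.contDiffOn).contDiffAt
      (hO.mem_nhds ⟨hy, hU⟩)
    refine (h1.congr_of_eventuallyEq ?_).contDiffWithinAt
    filter_upwards [hO.mem_nhds ⟨hy, hU⟩] with z hz using ρ.extension_eq hα hz.1 hz.2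
  · obtain ⟨U, α, hU, hα⟩ := ω.2 y
    rw [ρ.extension_eq hα (ρ.subset y.2) (by rwa [ρ.eq_self _ y.2]),
      ρ.restrictAt_ambientPullback y.2, hα.eq_restrict y hU]

-- Pulling `α` back along the retraction gives a form that vanishes identically near `x`, hence so
-- does its derivative. Pullback commutes with `d` and does not change restrictions to `M`.
include ρ in
theorem restrictAt_extDeriv_eq_zero {k : ℕ} {U : Set E} (hU : IsOpen U)
    {α : E → E [⋀^Fin k]→L[ℝ] ℝ} (hα : ContDiffOn ℝ (⊤ : ℕ∞) α U)
    (h0 : ∀ y ∈ M, y ∈ U → restrictAt M y (α y) = 0) {x : E} (hx : x ∈ M) (hxU : x ∈ U) :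
    restrictAt M x (extDeriv α x) = 0 := by
  have hRx : ρ.toFun x ∈ U := by rwa [ρ.eq_self x hx]
  rw [← ρ.restrictAt_ambientPullback hx,
    ← extDeriv_ambientPullback ρ.isOpen ρ.contDiffOn hU hα (ρ.subset hx) hRx]
  have h : ambientPullback ρ.toFun α =ᶠ[𝓝 x] (0 : ℝ) • ambientPullback ρ.toFun α := by
    have hO : IsOpen (ρ.domain ∩ ρ.toFun ⁻¹' U) :=
      ρ.contDiffOn.continuousOn.isOpen_inter_preimage ρ.isOpen hU
    filter_upwards [hO.mem_nhds ⟨ρ.subset hx, hRx⟩] with y hy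
    rw [zero_smul]
    ext v
    exact apply_eq_of_restrictAt_eq (B := 0) (h0 _ (ρ.mapsTo hy.1) hy.2)
      fun i => ρ.fderiv_mem hy.1 (v i)
  rw [h.extDeriv_eq, extDeriv_smul, zero_smul]
  rfl

-- Two extensions of `ω` differ by a form restricting to zero on `M`, so `dω` may be computed from
-- any of them.
include ρ in
theorem extDeriv_eq_restrictAt {k : ℕ} {ω : Form M k} {η : Form M (k + 1)}
    (h : IsExtDeriv ω η) {U : Set E} {α : E → E [⋀^Fin k]→L[ℝ] ℝ}
    (hα : IsLocalExtension ω.1 U α) (x : M) (hx : (x : E) ∈ U) :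
    η.1 x = restrictAt M x (extDeriv α x) := by
  obtain ⟨V, β, hV, hβ, e⟩ := h x
  rw [e]
  have h0 := ρ.restrictAt_extDeriv_eq_zero (hβ.isOpen.inter hα.isOpen) (α := β + (-1 : ℝ) • α)
    ((hβ.contDiffOn.mono inter_subset_left).add
      ((hα.contDiffOn.mono inter_subset_right).const_smul (-1 : ℝ)))
    (fun y hy hyU => by
      have h1 := hβ.eq_restrict ⟨y, hy⟩ hyU.1
      rw [hα.eq_restrict ⟨y, hy⟩ hyU.2] at h1
      exact restrictAt_sub_eq_zero_iff.2 h1.symm) x.2 ⟨hV, hx⟩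
  have d1 : DifferentiableAt ℝ α x :=
    (hα.contDiffOn.contDiffAt (hα.isOpen.mem_nhds hx)).differentiableAt (by simp)
  rw [extDeriv_add
    ((hβ.contDiffOn.contDiffAt (hβ.isOpen.mem_nhds hV)).differentiableAt (by simp))
    (d1.const_smul _), extDeriv_smul] at h0
  exact restrictAt_sub_eq_zero_iff.1 h0

end NbhdRetraction

/-! ### Pullback along locally defined maps -/

namespace NbhdRetraction

variable {M : Set E} {N : Set F} {P : Set G} (ρ : NbhdRetraction N) (ρP : NbhdRetraction P)

/-- The value at `x` of the pullback to `M` of a form on `N` along a map which is smooth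
near `x`. -/
def pull (M : Set E) (f : E → F) {k : ℕ} (ω : Form N k) (x : E) :
    tangentSpace M x [⋀^Fin k]→L[ℝ] ℝ :=
  restrictAt M x (ambientPullback f (ρ.extension ω) x)

theorem pull_congr {f g : E → F} {x : E} (hx : x ∈ M) (hf : DifferentiableAt ℝ f x)
    (hg : DifferentiableAt ℝ g x) (h : f =ᶠ[𝓝[M] x] g) {k : ℕ} (ω : Form N k) :
    ρ.pull M f ω x = ρ.pull M g ω x :=
  restrictAt_ambientPullback_congr_map hx hf hg h _

theorem pull_eq {f : E → F} {x : E} (hx : x ∈ M) (hf : IsSmoothAt M N f x) {k : ℕ}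
    {ω : Form N k} {U : Set F} {α : F → F [⋀^Fin k]→L[ℝ] ℝ} (hα : IsLocalExtension ω.1 U α)
    (hU : f x ∈ U) : ρ.pull M f ω x = restrictAt M x (ambientPullback f α x) := by
  have hfx := hf.mapsTo hx
  refine restrictAt_ambientPullback_congr_form hf ?_
  rw [← hα.eq_restrict ⟨f x, hfx⟩ hU, ← (ρ.isLocalExtension ω).eq_restrict ⟨f x, hfx⟩
    (ρ.subset hfx)]

theorem pullback_apply (φ : SmoothMap M N) {k : ℕ} (ω : Form N k) (x : M) :
    (φ.pullback k ω).1 x = ρ.pull M φ.toFun ω x :=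
  (φ.isLocalExtension (ρ.isLocalExtension ω)).eq_restrict x (ρ.subset (φ.mapsTo x.2))

theorem pull_pullback {f : E → F} {x : E} (hx : x ∈ M) (hf : IsSmoothAt M N f x)
    (φ : SmoothMap N P) {k : ℕ} (ω : Form P k) :
    ρ.pull M f (φ.pullback k ω) x = ρP.pull M (φ.toFun ∘ f) ω x := by
  rw [ρ.pull_eq hx hf (φ.isLocalExtension (ρP.isLocalExtension ω))
    (ρP.subset (φ.mapsTo (hf.mapsTo hx))), pull,
    ambientPullback_comp hf.differentiableAt (φ.differentiableAt _)]

theorem pullback_apply_of_pull (φ : SmoothMap M N) {f : F → G} {x : M}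
    (hf : IsSmoothAt N P f (φ.toFun x)) {k : ℕ} {ω : Form P k} {τ : Form N k}
    (h : τ.1 (φ.apply x) = ρP.pull N f ω (φ.toFun x)) :
    (φ.pullback k τ).1 x = ρP.pull M (f ∘ φ.toFun) ω x := by
  change (τ.1 (φ.apply x)).compContinuousLinearMap (φ.tangentMap x) = _
  rw [h, pull, pull, ambientPullback_comp (φ.differentiableAt _) hf.differentiableAt]
  rfl

/-- Gluing for a multivalued map: only the pullbacks along nearby local branches have to agree, not
the branches themselves. -/
theorem exists_form_of_pull {k : ℕ} (ω : Form N k) (f : M → E → F)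
    (hf : ∀ x : M, IsSmoothAt M N (f x) x)
    (hc : ∀ x : M, ∃ O, IsOpen O ∧ (x : E) ∈ O ∧
      ∀ y : M, (y : E) ∈ O → ρ.pull M (f y) ω y = ρ.pull M (f x) ω y) :
    ∃ τ : Form M k, ∀ x : M, τ.1 x = ρ.pull M (f x) ω x := by
  refine ⟨⟨fun x => ρ.pull M (f x) ω x, fun x => ?_⟩, fun x => rfl⟩
  obtain ⟨O, hO, hxO, hc⟩ := hc x
  have hfx := (hf x).mapsTo x.2
  obtain ⟨V, hV, hxV, hfV, -⟩ := hf x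
  have hW : IsOpen (V ∩ (f x) ⁻¹' ρ.domain) :=
    hfV.continuousOn.isOpen_inter_preimage hV ρ.isOpen
  refine ⟨O ∩ (V ∩ (f x) ⁻¹' ρ.domain), ambientPullback (f x) (ρ.extension ω),
    ⟨hxO, hxV, ρ.subset hfx⟩, hO.inter hW, ?_, fun y hy => hc y hy.1⟩
  exact (contDiffOn_ambientPullback hV hfV (ρ.isLocalExtension ω).contDiffOn).mono
    inter_subset_right

theorem isExtDeriv_of_pull {k : ℕ} {ω : Form N k} {η : Form N (k + 1)} (h : IsExtDeriv ω η)
    {f : M → E → F} (hf : ∀ x : M, IsSmoothAt M N (f x) x) {τ : Form M k} {θ : Form M (k + 1)}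
    (hτ : ∀ x : M, ∃ O, IsOpen O ∧ (x : E) ∈ O ∧
      ∀ y : M, (y : E) ∈ O → τ.1 y = ρ.pull M (f x) ω y)
    (hθ : ∀ x : M, θ.1 x = ρ.pull M (f x) η x) : IsExtDeriv τ θ := by
  intro x
  obtain ⟨O, hO, hxO, hc⟩ := hτ x
  have hfx := (hf x).mapsTo x.2
  have hsm := hf x
  obtain ⟨V, hV, hxV, hfV, -⟩ := hf x
  have hW : IsOpen (V ∩ (f x) ⁻¹' ρ.domain) :=
    hfV.continuousOn.isOpen_inter_preimage hV ρ.isOpen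
  have hα := ρ.isLocalExtension ω
  refine ⟨O ∩ (V ∩ (f x) ⁻¹' ρ.domain), ambientPullback (f x) (ρ.extension ω),
    ⟨hxO, hxV, ρ.subset hfx⟩, ⟨hO.inter hW, ?_, fun y hy => hc y hy.1⟩, ?_⟩
  · exact (contDiffOn_ambientPullback hV hfV hα.contDiffOn).mono inter_subset_right
  · rw [hθ, extDeriv_ambientPullback hV hfV ρ.isOpen hα.contDiffOn hxV (ρ.subset hfx)]
    refine restrictAt_ambientPullback_congr_form hsm ?_
    rw [← ρ.extDeriv_eq_restrictAt h hα ⟨_, hfx⟩ (ρ.subset hfx),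
      ← (ρ.isLocalExtension η).eq_restrict ⟨_, hfx⟩ (ρ.subset hfx)]

end NbhdRetraction

end DeRham
end

/-! ### Homotopy invariance of closed forms, and averaging. -/

noncomputable section

open Set Filter Topology

namespace DeRham

universe u

section Homotopy

variable {E : Type u} [NormedAddCommGroup E] [NormedSpace ℝ E] [FiniteDimensional ℝ E]
  {F : Type*} [NormedAddCommGroup F] [NormedSpace ℝ F] {M : Set E} {N : Set F}

omit [FiniteDimensional ℝ E] in
theorem sliceCLM_ambientPullback {H : ℝ × E → F} {t : ℝ} {x : E}
    (hH : DifferentiableAt ℝ H (t, x)) {k : ℕ} (α : F → F [⋀^Fin k]→L[ℝ] ℝ) :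
    sliceCLM E k (ambientPullback H α (t, x)) = ambientPullback (fun y => H (t, y)) α x := by
  have h : fderiv ℝ (fun y => H (t, y)) x =
      (fderiv ℝ H (t, x)).comp (ContinuousLinearMap.inr ℝ ℝ E) :=
    (hH.hasFDerivAt.comp x (hasFDerivAt_prodMk_right t x)).fderiv
  unfold ambientPullback
  rw [h]
  rfl

/-- The extension of `ω` is only known to be closed along tangent vectors of `N`. Since `H` sends
the open set `ℝ × U` into `N`, every ambient vector is mapped to such a vector, so the pullback
along `H` is genuinely closed and the flat homotopy operator applies. -/
theorem sub_mem_exactForms_of_nbhd_homotopy (ρN : NbhdRetraction N) {U : Set E} (hU : IsOpen U)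
    (hMU : M ⊆ U) {H : ℝ × E → F} (hH : ContDiffOn ℝ (⊤ : ℕ∞) H (univ ×ˢ U))
    (hm : ∀ t, ∀ x ∈ U, H (t, x) ∈ N) {k : ℕ} {ω : Form N k} (hω : IsExtDeriv ω 0)
    {τ₀ τ₁ : Form M k} (h₀ : ∀ x : M, τ₀.1 x = ρN.pull M (fun y => H (0, y)) ω x)
    (h₁ : ∀ x : M, τ₁.1 x = ρN.pull M (fun y => H (1, y)) ω x) :
    τ₁ - τ₀ ∈ exactForms (allForms M) k := by
  have hW : IsOpen ((univ : Set ℝ) ×ˢ U) := isOpen_univ.prod hU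
  have hα := ρN.isLocalExtension ω
  have hd (t : ℝ) {x : E} (hx : x ∈ U) : DifferentiableAt ℝ H (t, x) :=
    (hH.contDiffAt (hW.mem_nhds ⟨trivial, hx⟩)).differentiableAt (by simp)
  have hβ : ContDiffOn ℝ (⊤ : ℕ∞) (ambientPullback H (ρN.extension ω)) (univ ×ˢ U) :=
    (contDiffOn_ambientPullback hW hH hα.contDiffOn).mono
      fun p hp => ⟨hp, ρN.subset (hm p.1 p.2 hp.2)⟩
  have hc (t : ℝ) {x : E} (hx : x ∈ U) :
      extDeriv (ambientPullback H (ρN.extension ω)) (t, x) = 0 := by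
    have hN := hm t x hx
    rw [extDeriv_ambientPullback hW hH ρN.isOpen hα.contDiffOn ⟨trivial, hx⟩ (ρN.subset hN)]
    have h0 := ρN.extDeriv_eq_restrictAt hω hα ⟨_, hN⟩ (ρN.subset hN)
    have hs : IsSmoothAt (univ ×ˢ U) N H (t, x) :=
      ⟨univ ×ˢ U, hW, ⟨trivial, hx⟩, hH, fun p hp => hm _ _ hp.1.2⟩
    ext v
    refine (apply_eq_of_restrictAt_eq (B := 0) h0.symm fun i => ?_)
    refine hs.fderiv_mem (Submodule.subset_span ?_)
    rw [tangentConeAt_of_mem_nhds (hW.mem_nhds ⟨trivial, hx⟩)]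
    trivial
  have hs (t : ℝ) (x : M) : ρN.pull M (fun y => H (t, y)) ω x =
      restrictAt M x (sliceCLM E k (ambientPullback H (ρN.extension ω) (t, x))) := by
    rw [sliceCLM_ambientPullback (hd t (hMU x.2))]
    rfl
  cases k with
  | zero =>
    have : τ₁ = τ₀ := by
      apply Subtype.ext
      funext x
      rw [h₁, h₀, hs, hs, slice_eq_of_closed_zeroForm hU hβ (hMU x.2) fun t => hc t (hMU x.2)]
    rw [this, sub_self]
    exact Submodule.zero_mem _
  | succ k =>
    have hK := contDiffOn_fibreIntegral hU hβ
    let η : Form M k := ⟨fun x => restrictAt M x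
      (fibreIntegral (ambientPullback H (ρN.extension ω)) x),
      fun x => ⟨U, _, hMU x.2, hU, hK, fun _ _ => rfl⟩⟩
    refine ⟨(η, τ₁ - τ₀), ⟨fun x => ⟨U, _, hMU x.2, ⟨hU, hK, fun _ _ => rfl⟩, ?_⟩, trivial⟩, rfl⟩
    rw [extDeriv_fibreIntegral hU hβ (hMU x.2) fun t => hc t (hMU x.2)]
    change τ₁.1 x - τ₀.1 x = _
    rw [h₁, h₀, hs, hs]
    rfl

/-- Pullbacks of a closed form along smoothly homotopic maps are cohomologous. -/
theorem sub_mem_exactForms_of_homotopy (ρM : NbhdRetraction M) (ρN : NbhdRetraction N)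
    {O : Set E} (hO : IsOpen O) (hMO : M ⊆ O) {H : ℝ × E → F}
    (hH : ContDiffOn ℝ (⊤ : ℕ∞) H (univ ×ˢ O)) (hm : ∀ t, ∀ x ∈ M, H (t, x) ∈ N) {k : ℕ}
    {ω : Form N k} (hω : IsExtDeriv ω 0) {τ₀ τ₁ : Form M k}
    (h₀ : ∀ x : M, τ₀.1 x = ρN.pull M (fun y => H (0, y)) ω x)
    (h₁ : ∀ x : M, τ₁.1 x = ρN.pull M (fun y => H (1, y)) ω x) :
    τ₁ - τ₀ ∈ exactForms (allForms M) k := by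
  have hU : IsOpen (ρM.domain ∩ ρM.toFun ⁻¹' O) :=
    ρM.contDiffOn.continuousOn.isOpen_inter_preimage ρM.isOpen hO
  have hMU : M ⊆ ρM.domain ∩ ρM.toFun ⁻¹' O :=
    fun x hx => ⟨ρM.subset hx, by rw [mem_preimage, ρM.eq_self x hx]; exact hMO hx⟩
  have hW : IsOpen ((univ : Set ℝ) ×ˢ O) := isOpen_univ.prod hO
  have hR : ContDiffOn ℝ (⊤ : ℕ∞) (fun p : ℝ × E => (p.1, ρM.toFun p.2))
      (univ ×ˢ (ρM.domain ∩ ρM.toFun ⁻¹' O)) :=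
    contDiffOn_fst.prodMk (ρM.contDiffOn.comp contDiffOn_snd fun p hp => hp.2.1)
  -- Composing with the retraction onto `M` turns a homotopy that respects only `M` into one sending
  -- an open neighbourhood into `N`.
  have hH' : ContDiffOn ℝ (⊤ : ℕ∞) (fun p : ℝ × E => H (p.1, ρM.toFun p.2))
      (univ ×ˢ (ρM.domain ∩ ρM.toFun ⁻¹' O)) := hH.comp hR fun p hp => ⟨trivial, hp.2.2⟩
  have hp (t : ℝ) (x : M) : ρN.pull M (fun y => H (t, y)) ω x =
      ρN.pull M (fun y => H (t, ρM.toFun y)) ω x := by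
    have hd : ∀ x ∈ O, DifferentiableAt ℝ (fun y => H (t, y)) x := fun x hx =>
      ((hH.contDiffAt (hW.mem_nhds ⟨trivial, hx⟩)).differentiableAt (by simp)).comp x
        (hasFDerivAt_prodMk_right t x).differentiableAt
    refine ρN.pull_congr x.2 (hd x (hMO x.2)) ?_ ?_ ω
    · refine DifferentiableAt.comp (g := fun y => H (t, y)) (x : E) (hd _ (hMU x.2).2) ?_
      exact (ρM.isSmoothAt (S := M) (ρM.subset x.2)).differentiableAt
    · filter_upwards [self_mem_nhdsWithin] with y hy
      rw [ρM.eq_self y hy]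
  exact sub_mem_exactForms_of_nbhd_homotopy ρN hU hMU hH'
    (fun t x hx => hm t _ (ρM.mapsTo hx.1)) hω (fun x => by rw [h₀, hp]) (fun x => by rw [h₁, hp])

end Homotopy

variable {E : Type*} [NormedAddCommGroup E] [NormedSpace ℝ E]
  {F : Type*} [NormedAddCommGroup F] [NormedSpace ℝ F] {M : Set E} {N : Set F}

theorem SmoothMap.pullback_mem_exactForms (φ : SmoothMap M N) {k : ℕ} {ω : Form N k}
    (h : ω ∈ exactForms (allForms N) k) : φ.pullback k ω ∈ exactForms (allForms M) k := by
  cases k with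
  | zero =>
    have h0 : ω = 0 := h
    rw [h0, map_zero]
    exact Submodule.zero_mem _
  | succ k =>
    obtain ⟨⟨η, ω₁⟩, ⟨hd, -⟩, rfl⟩ := h
    exact ⟨(φ.pullback k η, φ.pullback (k + 1) ω₁), ⟨φ.pullback_isExtDeriv hd, trivial⟩, rfl⟩

theorem SmoothMap.pullback_isClosed (φ : SmoothMap M N) {k : ℕ} {ω : Form N k}
    (h : IsExtDeriv ω 0) : IsExtDeriv (φ.pullback k ω) 0 := by
  simpa using φ.pullback_isExtDeriv h

theorem SmoothMap.pullback_congr {φ ψ : SmoothMap M N} (h : EqOn φ.toFun ψ.toFun M) (k : ℕ) :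
    φ.pullback k = ψ.pullback k := by
  ext ω
  apply Subtype.ext
  funext x
  obtain ⟨U, α, hU, hα⟩ := ω.2 (φ.apply x)
  have hU' : ψ.toFun x ∈ U := by
    rw [← h x.2]
    exact hU
  have h1 := (φ.isLocalExtension hα).eq_restrict x hU
  have h2 := (ψ.isLocalExtension hα).eq_restrict x hU'
  refine h1.trans (Eq.trans ?_ h2.symm)
  exact restrictAt_ambientPullback_congr_map x.2 (φ.differentiableAt x) (ψ.differentiableAt x)
    (h.eventuallyEq_nhdsWithin) _

theorem SmoothMap.pullback_eq_self {φ : SmoothMap M M} (h : ∀ x ∈ M, φ.toFun x = x) {k : ℕ}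
    (ω : Form M k) : φ.pullback k ω = ω := by
  have h1 := SmoothMap.pullback_congr (φ := φ) (ψ := ⟨id, contDiff_id, mapsTo_id M⟩) h k
  rw [h1]
  apply Subtype.ext
  funext x
  ext v
  change ω.1 x (fun i => _) = ω.1 x v
  congr 1
  funext i
  apply Subtype.ext
  change fderiv ℝ id (x : E) (v i : E) = v i
  rw [fderiv_id]
  rfl

theorem SmoothMap.cohomologyMap_bijective (φ : SmoothMap M N)
    {T : ∀ k, Submodule ℝ (Form N k)} {S : ∀ k, Submodule ℝ (Form M k)}
    (hTS : ∀ k, ∀ ω ∈ T k, φ.pullback k ω ∈ S k) {k : ℕ}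
    (hinj : ∀ ω ∈ closedForms T k, φ.pullback k ω ∈ exactForms S k → ω ∈ exactForms T k)
    (hsurj : ∀ ω ∈ closedForms S k, ∃ τ ∈ closedForms T k,
      φ.pullback k τ - ω ∈ exactForms S k) :
    Function.Bijective (φ.cohomologyMap T S hTS k) := by
  constructor
  · rw [injective_iff_map_eq_zero]
    intro c hc
    obtain ⟨⟨ω, hω⟩, rfl⟩ := Submodule.Quotient.mk_surjective _ c
    rw [Submodule.Quotient.mk_eq_zero]
    refine hinj ω hω ?_
    exact (Submodule.Quotient.mk_eq_zero ((exactForms S k).submoduleOf (closedForms S k))).1 hc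
  · intro c
    obtain ⟨⟨ω, hω⟩, rfl⟩ := Submodule.Quotient.mk_surjective _ c
    obtain ⟨τ, hτ, h⟩ := hsurj ω hω
    refine ⟨Submodule.Quotient.mk ⟨τ, hτ⟩, ?_⟩
    exact (Submodule.Quotient.eq _).2 h

/-! ### Averaging over a finite group -/

section Average

variable {ι : Type*} [Fintype ι]

/-- The average of the pullbacks along a finite family of maps. -/
def average (g : ι → SmoothMap M M) (k : ℕ) : Form M k →ₗ[ℝ] Form M k :=
  (Fintype.card ι : ℝ)⁻¹ • ∑ i, (g i).pullback k

theorem average_apply (g : ι → SmoothMap M M) (k : ℕ) (ω : Form M k) :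
    average g k ω = (Fintype.card ι : ℝ)⁻¹ • ∑ i, (g i).pullback k ω := by
  simp [average, LinearMap.sum_apply]

theorem average_isExtDeriv (g : ι → SmoothMap M M) {k : ℕ} {ω : Form M k} {η : Form M (k + 1)}
    (h : IsExtDeriv ω η) : IsExtDeriv (average g k ω) (average g (k + 1) η) := by
  have hm : (Fintype.card ι : ℝ)⁻¹ • ∑ i, ((g i).pullback k ω, (g i).pullback (k + 1) η) ∈
      extDerivGraph M k :=
    Submodule.smul_mem _ _ (Submodule.sum_mem _ fun i _ => (g i).pullback_isExtDeriv h)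
  have he : (Fintype.card ι : ℝ)⁻¹ • ∑ i, ((g i).pullback k ω, (g i).pullback (k + 1) η) =
      (average g k ω, average g (k + 1) η) := by
    simp [average_apply, Prod.ext_iff, Prod.fst_sum, Prod.snd_sum]
  rw [he] at hm
  exact hm

theorem average_isClosed (g : ι → SmoothMap M M) {k : ℕ} {ω : Form M k}
    (h : IsExtDeriv ω 0) : IsExtDeriv (average g k ω) 0 := by
  simpa using average_isExtDeriv g h

theorem average_mem_exactForms (g : ι → SmoothMap M M) {k : ℕ} {ω : Form M k}
    (h : ω ∈ exactForms (allForms M) k) : average g k ω ∈ exactForms (allForms M) k := by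
  rw [average_apply]
  exact Submodule.smul_mem _ _ (Submodule.sum_mem _ fun i _ => (g i).pullback_mem_exactForms h)

theorem average_sub_mem_exactForms [Nonempty ι] (g : ι → SmoothMap M M) {k : ℕ} {ω : Form M k}
    (h : ∀ i, (g i).pullback k ω - ω ∈ exactForms (allForms M) k) :
    average g k ω - ω ∈ exactForms (allForms M) k := by
  have he : average g k ω - ω = (Fintype.card ι : ℝ)⁻¹ • ∑ i, ((g i).pullback k ω - ω) := by
    have hne : (Fintype.card ι : ℝ) ≠ 0 := by simp
    rw [average_apply, Finset.sum_sub_distrib, Finset.sum_const, smul_sub, Finset.card_univ,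
      ← Nat.cast_smul_eq_nsmul ℝ, smul_smul, inv_mul_cancel₀ hne, one_smul]
  rw [he]
  exact Submodule.smul_mem _ _ (Submodule.sum_mem _ fun i _ => h i)

theorem average_eq_self [Nonempty ι] {g : ι → SmoothMap M M} {k : ℕ} {ω : Form M k}
    (h : ω ∈ invariantForms g k) : average g k ω = ω := by
  have hne : (Fintype.card ι : ℝ) ≠ 0 := by simp
  rw [average_apply, Finset.sum_congr rfl fun i _ => h i, Finset.sum_const, Finset.card_univ,
    ← Nat.cast_smul_eq_nsmul ℝ, smul_smul, inv_mul_cancel₀ hne, one_smul]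

variable [Group ι] {g : ι → SmoothMap M M}
  (hg : ∀ i j, EqOn ((g j).comp (g i)).toFun (g (j * i)).toFun M)

-- Pullback along `g i` permutes the summands by right multiplication with `i`.
include hg in
theorem average_mem_invariantForms {k : ℕ} (ω : Form M k) :
    average g k ω ∈ invariantForms g k := by
  intro i
  rw [average_apply, map_smul, map_sum]
  congr 1
  simp only [← SmoothMap.pullback_comp, SmoothMap.pullback_congr (hg i _)]
  exact Equiv.sum_comp (Equiv.mulRight i) fun j => (g j).pullback k ω

-- The average of a primitive is an invariant primitive of the average, and the average of an
-- invariant form is the form itself.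
include hg in
theorem mem_exactForms_invariantForms {k : ℕ} {ω : Form M k} (hω : ω ∈ invariantForms g k)
    (h : ω ∈ exactForms (allForms M) k) : ω ∈ exactForms (invariantForms g) k := by
  cases k with
  | zero => exact h
  | succ k =>
    obtain ⟨⟨η, ω₁⟩, ⟨hd, -⟩, rfl⟩ := h
    refine ⟨(average g k η, average g (k + 1) ω₁),
      ⟨average_isExtDeriv g hd, average_mem_invariantForms hg η⟩, ?_⟩
    exact average_eq_self hω

omit [Fintype ι] [Group ι] in
theorem exactForms_le_allForms (S : ∀ k, Submodule ℝ (Form M k)) (k : ℕ) :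
    exactForms S k ≤ exactForms (allForms M) k := by
  cases k with
  | zero => exact le_rfl
  | succ k => exact Submodule.map_mono (inf_le_inf_left _ fun _ _ => trivial)

end Average

end DeRham
end

/-! ### An explicit smooth retraction onto `W̃_{r,1}`. -/

noncomputable section

open Set Filter Topology DeRham
open scoped ComplexConjugate

namespace Conifold

/-- The complex quadric `z_1² + z_2² + z_4²`. -/
def partialQuadric (c : C4) : ℂ := c 0 ^ 2 + c 1 ^ 2 + c 3 ^ 2

/-- The complex quadric `z_1² + z_2² + z_3² + z_4²`. -/
def quadric (c : C4) : ℂ := partialQuadric c + c 2 ^ 2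

/-- `|z_1|² + |z_2|² + |z_4|²`. -/
def partialNormSq (c : C4) : ℝ := ‖c 0‖ ^ 2 + ‖c 1‖ ^ 2 + ‖c 3‖ ^ 2

/-- `|z_1|² + |z_2|² + |z_3|² + |z_4|²`. -/
def totalNormSq (c : C4) : ℝ := partialNormSq c + ‖c 2‖ ^ 2

/-- The map `z_3 ↦ z_3 ^ r` of the ambient spaces. -/
def cover (r : ℕ) (z : C4) : C4 := ![z 0, z 1, z 2 ^ r, z 3]

theorem contDiff_cover (r : ℕ) : ContDiff ℝ (⊤ : ℕ∞) (cover r) := (branchedCover r 1).contDiff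

/-- For `c = x + i y` the quadric has real part `|x|² - |y|²` and imaginary part `2⟨x, y⟩`, while
the total norm is `|x|² + |y|²`. -/
theorem mem_Wtilde_iff {r : ℕ} {z : C4} :
    z ∈ Wtilde r 1 ↔ quadric (cover r z) = 0 ∧ totalNormSq (cover r z) = 2 := by
  have hn (w : ℂ) : ‖w‖ ^ 2 = w.re ^ 2 + w.im ^ 2 := by
    rw [Complex.sq_norm, Complex.normSq_apply]; ring
  simp only [Wtilde, mem_ofPred_eq, quadric, partialQuadric, totalNormSq, partialNormSq, cover,
    Complex.ext_iff, hn, Matrix.cons_val_zero, Matrix.cons_val_one, Matrix.cons_val,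
    Complex.add_re, Complex.add_im, Complex.zero_re, Complex.zero_im, pow_two (_ : ℂ),
    Complex.mul_re, Complex.mul_im]
  generalize z 2 ^ r = w
  constructor
  · rintro ⟨h1, h2, h3⟩
    refine ⟨⟨?_, ?_⟩, ?_⟩
    · linear_combination h1 - h2
    · linear_combination 2 * h3
    · linear_combination h1 + h2
  · rintro ⟨⟨h1, h2⟩, h3⟩
    refine ⟨?_, ?_, ?_⟩
    · linear_combination (h1 + h3) / 2
    · linear_combination (h3 - h1) / 2
    · linear_combination h2 / 2

/-- The open set on which the retraction to the quadric cone is defined. -/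
def nearQuadric : Set C4 := {c | ‖quadric c‖ < partialNormSq c}

/-- The discriminant of the quadratic equation that moves a point to the quadric cone. -/
def discr (c : C4) : ℂ := (partialNormSq c : ℂ) ^ 2 - conj (partialQuadric c) * quadric c

/-- The principal square root. -/
def csqrt (w : ℂ) : ℂ := Complex.exp (Complex.log w / 2)

/-- The coefficient `α` for which `z' + α z̄'` lies on the quadric cone. -/
def correction (c : C4) : ℂ := -quadric c / (partialNormSq c + csqrt (discr c))

/-- `z_j ↦ z_j + α z̄_j` for `j = 1, 2, 4`. -/
def toQuadric (c : C4) : C4 :=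
  ![c 0 + correction c * conj (c 0), c 1 + correction c * conj (c 1), c 2,
    c 3 + correction c * conj (c 3)]

/-- The factor which normalizes a point of the quadric cone. -/
def scaleFactor (c : C4) : ℝ := Real.sqrt (2 / totalNormSq (toQuadric c))

/-- The retraction of a neighbourhood of `W̃_{r,1}` onto `W̃_{r,1}`. -/
def retract (r : ℕ) (z : C4) : C4 :=
  ![scaleFactor (cover r z) * toQuadric (cover r z) 0,
    scaleFactor (cover r z) * toQuadric (cover r z) 1,
    (scaleFactor (cover r z) ^ (1 / (r : ℝ)) : ℝ) * z 2,
    scaleFactor (cover r z) * toQuadric (cover r z) 3]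

theorem norm_partialQuadric_le (c : C4) : ‖partialQuadric c‖ ≤ partialNormSq c := by
  unfold partialQuadric partialNormSq
  refine (norm_add₃_le).trans (le_of_eq ?_)
  simp

theorem csqrt_sq {w : ℂ} (hw : w ≠ 0) : csqrt w ^ 2 = w := by
  rw [csqrt, ← Complex.exp_nat_mul]
  conv_rhs => rw [← Complex.exp_log hw]
  congr 1
  push_cast
  ring

theorem csqrt_re_nonneg (w : ℂ) : 0 ≤ (csqrt w).re := by
  rw [csqrt, Complex.exp_re]
  refine mul_nonneg (Real.exp_pos _).le (Real.cos_nonneg_of_neg_pi_div_two_le_of_le ?_ ?_)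
  · have := Complex.neg_pi_lt_arg w
    simp only [Complex.div_ofNat_im, Complex.log_im]
    linarith
  · have := Complex.arg_le_pi w
    simp only [Complex.div_ofNat_im, Complex.log_im]
    linarith

section

variable {c : C4} (hc : c ∈ nearQuadric)
include hc

theorem partialNormSq_pos : 0 < partialNormSq c := (norm_nonneg _).trans_lt hc

/-- With `P`, `Q`, `N` the partial quadric, quadric and partial norm, `|P| ≤ N` and `|Q| < N` give
`|P̄ Q| < N²`. The discriminant thus stays in the slit plane, where the principal root is smooth. -/
theorem discr_re_pos : 0 < (discr c).re := by
  have hn := partialNormSq_pos hc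
  have h1 : ‖conj (partialQuadric c) * quadric c‖ < partialNormSq c ^ 2 := by
    rw [norm_mul, RCLike.norm_conj, sq]
    exact mul_lt_mul' (norm_partialQuadric_le c) hc (norm_nonneg _) hn
  have h2 := (Complex.re_le_norm (conj (partialQuadric c) * quadric c)).trans_lt h1
  have h3 : (discr c).re = partialNormSq c ^ 2 - (conj (partialQuadric c) * quadric c).re := by
    rw [discr, Complex.sub_re, ← Complex.ofReal_pow, Complex.ofReal_re]
  linarith

theorem discr_ne_zero : discr c ≠ 0 := fun h => by
  have := discr_re_pos hc
  simp [h] at this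

omit hc in
theorem partialNormSq_le_denom (c : C4) : partialNormSq c ≤ ‖(partialNormSq c : ℂ) + csqrt (discr c)‖ := by
  refine le_trans ?_ (Complex.re_le_norm _)
  rw [Complex.add_re, Complex.ofReal_re]
  linarith [csqrt_re_nonneg (discr c)]

theorem denom_ne_zero : (partialNormSq c : ℂ) + csqrt (discr c) ≠ 0 :=
  norm_pos_iff.1 ((partialNormSq_pos hc).trans_le (partialNormSq_le_denom c))

/-- This keeps `w + α w̄` nonzero for `w ≠ 0`, so the corrected point can be normalized. -/
theorem norm_correction_lt_one : ‖correction c‖ < 1 := by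
  have h := partialNormSq_le_denom c
  rw [correction, norm_div, norm_neg, div_lt_one ((partialNormSq_pos hc).trans_le h)]
  exact lt_of_lt_of_le hc h

/-- The left side is the quadric at the corrected point. Of the two roots of this equation in `α`,
the chosen one, in rationalized form, vanishes where the quadric does, and it needs no division by
`P̄`. -/
theorem correction_spec : quadric c + 2 * correction c * partialNormSq c +
    correction c ^ 2 * conj (partialQuadric c) = 0 := by
  have hs := csqrt_sq (discr_ne_zero hc)
  have hd := denom_ne_zero hc
  have h1 : correction c * (partialNormSq c + csqrt (discr c)) = -quadric c := by
    rw [correction, div_mul_cancel₀ _ hd]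
  have h2 : discr c = (partialNormSq c : ℂ) ^ 2 - conj (partialQuadric c) * quadric c := rfl
  set n : ℂ := (partialNormSq c : ℂ)
  set s := csqrt (discr c)
  have h3 : (n + s) ^ 2 * (quadric c + 2 * correction c * n +
      correction c ^ 2 * conj (partialQuadric c)) = 0 := by
    have : (n + s) ^ 2 * (quadric c + 2 * correction c * n +
      correction c ^ 2 * conj (partialQuadric c)) = (n + s) ^ 2 * quadric c +
      2 * n * (n + s) * (correction c * (n + s)) +
      (correction c * (n + s)) ^ 2 * conj (partialQuadric c) := by ring
    rw [this, h1]
    linear_combination quadric c * (hs + h2)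
  exact (mul_eq_zero.1 h3).resolve_left (pow_ne_zero 2 hd)

theorem quadric_toQuadric : quadric (toQuadric c) = 0 := by
  have h := correction_spec hc
  have hm (w : ℂ) : ((‖w‖ : ℝ) : ℂ) ^ 2 = w * conj w := by
    rw [Complex.mul_conj, Complex.normSq_eq_norm_sq]
    push_cast
    rfl
  simp only [quadric, partialQuadric, partialNormSq, Complex.ofReal_add, Complex.ofReal_pow, hm,
    map_add, map_pow] at h
  simp only [quadric, partialQuadric, toQuadric, Matrix.cons_val_zero, Matrix.cons_val_one,
    Matrix.cons_val]
  linear_combination h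

theorem totalNormSq_toQuadric_pos : 0 < totalNormSq (toQuadric c) := by
  have hα := norm_correction_lt_one hc
  have key (w : ℂ) : (1 - ‖correction c‖) ^ 2 * ‖w‖ ^ 2 ≤ ‖w + correction c * conj w‖ ^ 2 := by
    rw [← mul_pow]
    refine pow_le_pow_left₀ (mul_nonneg (by linarith) (norm_nonneg _)) ?_ 2
    have := norm_sub_le_norm_add w (correction c * conj w)
    rw [norm_mul, RCLike.norm_conj] at this
    linarith
  have h : (1 - ‖correction c‖) ^ 2 * partialNormSq c ≤ partialNormSq (toQuadric c) := by
    simp only [partialNormSq, toQuadric, Matrix.cons_val_zero, Matrix.cons_val_one,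
      Matrix.cons_val]
    linarith [key (c 0), key (c 1), key (c 3)]
  have h2 : 0 < (1 - ‖correction c‖) ^ 2 * partialNormSq c :=
    mul_pos (pow_pos (by linarith) 2) (partialNormSq_pos hc)
  exact add_pos_of_pos_of_nonneg (h2.trans_le h) (sq_nonneg _)

theorem scaleFactor_pos : 0 < scaleFactor c :=
  Real.sqrt_pos.2 (div_pos two_pos (totalNormSq_toQuadric_pos hc))

end

/-- The correction leaves the third coordinate alone, so upstairs only a positive real scalar needs
an `r`-th root. This keeps the retraction smooth across `z₃ = 0`. -/
theorem cover_retract {r : ℕ} (hr : 1 ≤ r) {z : C4} :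
    cover r (retract r z) = (scaleFactor (cover r z) : ℂ) • toQuadric (cover r z) := by
  funext i
  have hs : 0 ≤ scaleFactor (cover r z) := Real.sqrt_nonneg _
  have h : ((scaleFactor (cover r z) ^ (1 / (r : ℝ)) : ℝ) : ℂ) ^ r =
      (scaleFactor (cover r z) : ℂ) := by
    rw [← Complex.ofReal_pow, ← Real.rpow_natCast, ← Real.rpow_mul hs,
      one_div_mul_cancel (by positivity), Real.rpow_one]
  fin_cases i
  · simp [cover, retract]
  · simp [cover, retract]
  · change (((scaleFactor (cover r z) ^ (1 / (r : ℝ)) : ℝ) : ℂ) * z 2) ^ r = _ * z 2 ^ r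
    rw [mul_pow, h]
  · simp [cover, retract]

theorem quadric_smul (s : ℂ) (c : C4) : quadric (s • c) = s ^ 2 * quadric c := by
  simp [quadric, partialQuadric]
  ring

theorem totalNormSq_smul (s : ℂ) (c : C4) : totalNormSq (s • c) = ‖s‖ ^ 2 * totalNormSq c := by
  simp [totalNormSq, partialNormSq]
  ring

theorem retract_mem {r : ℕ} (hr : 1 ≤ r) {z : C4} (hz : cover r z ∈ nearQuadric) :
    retract r z ∈ Wtilde r 1 := by
  rw [mem_Wtilde_iff, cover_retract hr, quadric_smul, totalNormSq_smul, quadric_toQuadric hz,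
    mul_zero]
  refine ⟨rfl, ?_⟩
  have h := totalNormSq_toQuadric_pos hz
  rw [Complex.norm_real, Real.norm_of_nonneg (scaleFactor_pos hz).le, scaleFactor,
    Real.sq_sqrt (by positivity)]
  field_simp

theorem mem_nearQuadric_of_mem {r : ℕ} {z : C4} (hz : z ∈ Wtilde r 1) :
    cover r z ∈ nearQuadric := by
  obtain ⟨h1, h2⟩ := mem_Wtilde_iff.1 hz
  change ‖quadric (cover r z)‖ < partialNormSq (cover r z)
  have h3 : ‖cover r z 2‖ ^ 2 = ‖partialQuadric (cover r z)‖ := by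
    rw [← norm_pow, ← norm_neg, ← eq_neg_of_add_eq_zero_left h1]
  have h4 := norm_partialQuadric_le (cover r z)
  rw [totalNormSq] at h2
  rw [h1, norm_zero]
  linarith

theorem retract_eq_self {r : ℕ} {z : C4} (hz : z ∈ Wtilde r 1) :
    retract r z = z := by
  obtain ⟨h1, h2⟩ := mem_Wtilde_iff.1 hz
  have hα : correction (cover r z) = 0 := by simp [correction, h1]
  have ht : toQuadric (cover r z) = cover r z := by
    funext i
    fin_cases i <;> simp [toQuadric, hα]
  have hs : scaleFactor (cover r z) = 1 := by rw [scaleFactor, ht, h2]; simp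
  funext i
  fin_cases i <;> simp [retract, ht, hs] <;> simp [cover]

/-! ### Smoothness -/

theorem contDiff_coord (j : Fin 4) : ContDiff ℝ (⊤ : ℕ∞) (fun z : C4 => z j) :=
  contDiff_apply ℝ ℂ j

theorem contDiff_partialQuadric : ContDiff ℝ (⊤ : ℕ∞) partialQuadric :=
  (((contDiff_coord 0).pow 2).add ((contDiff_coord 1).pow 2)).add ((contDiff_coord 3).pow 2)

theorem contDiff_quadric : ContDiff ℝ (⊤ : ℕ∞) quadric :=
  contDiff_partialQuadric.add ((contDiff_coord 2).pow 2)

theorem contDiff_partialNormSq : ContDiff ℝ (⊤ : ℕ∞) partialNormSq :=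
  (((contDiff_coord 0).norm_sq ℝ).add ((contDiff_coord 1).norm_sq ℝ)).add
    ((contDiff_coord 3).norm_sq ℝ)

theorem contDiff_totalNormSq : ContDiff ℝ (⊤ : ℕ∞) totalNormSq :=
  contDiff_partialNormSq.add ((contDiff_coord 2).norm_sq ℝ)

theorem contDiff_conj {f : C4 → ℂ} (hf : ContDiff ℝ (⊤ : ℕ∞) f) :
    ContDiff ℝ (⊤ : ℕ∞) fun z => conj (f z) :=
  Complex.conjCLE.contDiff.comp hf

theorem contDiff_discr : ContDiff ℝ (⊤ : ℕ∞) discr :=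
  ((Complex.ofRealCLM.contDiff.comp contDiff_partialNormSq).pow 2).sub
    ((contDiff_conj contDiff_partialQuadric).mul contDiff_quadric)

theorem contDiffAt_clog {w : ℂ} (hw : w ∈ Complex.slitPlane) :
    ContDiffAt ℝ (⊤ : ℕ∞) Complex.log w :=
  (Complex.contDiffAt_log hw).restrict_scalars ℝ

theorem contDiff_cexp : ContDiff ℝ (⊤ : ℕ∞) Complex.exp :=
  (Complex.contDiff_exp (𝕜 := ℂ)).restrict_scalars ℝ

theorem isOpen_nearQuadric : IsOpen nearQuadric :=
  isOpen_lt contDiff_quadric.continuous.norm contDiff_partialNormSq.continuous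

theorem contDiffOn_correction : ContDiffOn ℝ (⊤ : ℕ∞) correction nearQuadric := by
  intro c hc
  refine ContDiffAt.contDiffWithinAt ?_
  have h1 : ContDiffAt ℝ (⊤ : ℕ∞) (fun c => csqrt (discr c)) c := by
    refine contDiff_cexp.contDiffAt.comp c (ContDiffAt.div_const ?_ 2)
    exact (contDiffAt_clog (Or.inl (discr_re_pos hc))).comp c contDiff_discr.contDiffAt
  have h2 : ContDiffAt ℝ (⊤ : ℕ∞) (fun c => (partialNormSq c : ℂ) + csqrt (discr c)) c :=
    (Complex.ofRealCLM.contDiff.comp contDiff_partialNormSq).contDiffAt.add h1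
  have h3 : correction = fun c => -quadric c * ((partialNormSq c : ℂ) + csqrt (discr c))⁻¹ :=
    funext fun _ => div_eq_mul_inv _ _
  rw [h3]
  exact contDiff_quadric.neg.contDiffAt.mul (h2.inv (denom_ne_zero hc))

theorem contDiffOn_toQuadric : ContDiffOn ℝ (⊤ : ℕ∞) toQuadric nearQuadric := by
  rw [contDiffOn_pi]
  have h (j : Fin 4) : ContDiffOn ℝ (⊤ : ℕ∞) (fun c : C4 => c j + correction c * conj (c j))
      nearQuadric :=
    (contDiff_coord j).contDiffOn.add
      (contDiffOn_correction.mul (contDiff_conj (contDiff_coord j)).contDiffOn)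
  intro i
  fin_cases i
  · exact h 0
  · exact h 1
  · exact (contDiff_coord 2).contDiffOn
  · exact h 3

theorem contDiffOn_scaleFactor : ContDiffOn ℝ (⊤ : ℕ∞) scaleFactor nearQuadric := by
  intro c hc
  have hp := totalNormSq_toQuadric_pos hc
  have h1 : ContDiffWithinAt ℝ (⊤ : ℕ∞) (fun c => totalNormSq (toQuadric c)) nearQuadric c :=
    contDiff_totalNormSq.comp_contDiffWithinAt (contDiffOn_toQuadric c hc)
  exact (contDiffWithinAt_const.div h1 hp.ne').sqrt (div_pos two_pos hp).ne'

theorem contDiffOn_retract (r : ℕ) :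
    ContDiffOn ℝ (⊤ : ℕ∞) (retract r) (cover r ⁻¹' nearQuadric) := by
  have h1 : ContDiffOn ℝ (⊤ : ℕ∞) (fun z => scaleFactor (cover r z)) (cover r ⁻¹' nearQuadric) :=
    contDiffOn_scaleFactor.comp (contDiff_cover r).contDiffOn fun _ h => h
  have h2 (j : Fin 4) : ContDiffOn ℝ (⊤ : ℕ∞)
      (fun z => (scaleFactor (cover r z) : ℂ) * toQuadric (cover r z) j)
      (cover r ⁻¹' nearQuadric) :=
    (Complex.ofRealCLM.contDiff.comp_contDiffOn h1).mul
      ((contDiff_coord j).comp_contDiffOn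
        (contDiffOn_toQuadric.comp (contDiff_cover r).contDiffOn fun _ h => h))
  rw [contDiffOn_pi]
  intro i
  fin_cases i
  · exact h2 0
  · exact h2 1
  · refine (Complex.ofRealCLM.contDiff.comp_contDiffOn fun z hz => ?_).mul
      (contDiff_coord 2).contDiffOn
    exact (h1 z hz).rpow_const_of_ne (scaleFactor_pos hz).ne'
  · exact h2 3

/-- `W̃_{r,1}` is a smooth neighbourhood retract. -/
def nbhdRetraction (r : ℕ) (hr : 1 ≤ r) : NbhdRetraction (Wtilde r 1) where
  domain := cover r ⁻¹' nearQuadric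
  toFun := retract r
  isOpen := isOpen_nearQuadric.preimage (contDiff_cover r).continuous
  subset := fun _ hz => mem_nearQuadric_of_mem hz
  contDiffOn := contDiffOn_retract r
  mapsTo := fun _ hz => retract_mem hr hz
  eq_self := fun _ hz => retract_eq_self hz

end Conifold
end

/-! ### Isotopies, collapsing maps, and the transfer to the base. -/

noncomputable section

open Set Filter Topology DeRham

namespace DeRham

variable {E : Type*} [NormedAddCommGroup E] [NormedSpace ℝ E] {M : Set E}

theorem NbhdRetraction.pull_eq_self (ρ : NbhdRetraction M) {f : E → E} (x : M)
    (hf : DifferentiableAt ℝ f x) (h : ∀ y ∈ M, f y = y) {k : ℕ} (ω : Form M k) :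
    ρ.pull M f ω x = ω.1 x := by
  rw [ρ.pull_congr (g := id) x.2 hf differentiableAt_id, NbhdRetraction.pull,
    (ρ.isLocalExtension ω).eq_restrict x (ρ.subset x.2)]
  · unfold ambientPullback
    rw [fderiv_id]
    rfl
  · filter_upwards [self_mem_nhdsWithin] with y hy using h y hy

theorem NbhdRetraction.pull_zero {F : Type*} [NormedAddCommGroup F] [NormedSpace ℝ F] {N : Set F}
    (ρ : NbhdRetraction N) {f : E → F} {x : E} (hx : x ∈ M) (hf : IsSmoothAt M N f x) (k : ℕ) :
    ρ.pull M f (0 : Form N k) x = 0 := by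
  exact ρ.pull_eq (ω := 0) (U := univ) (α := 0) hx hf (IsLocalExtension.zero N k) (mem_univ _)

end DeRham

namespace Conifold

/-! ### Isotopies to the identity -/

theorem pullback_sub_mem_exactForms {E : Type*} [NormedAddCommGroup E] [NormedSpace ℝ E]
    [FiniteDimensional ℝ E] {M : Set E} (ρ : NbhdRetraction M) (φ : SmoothMap M M) {H : ℝ × E → E}
    (hH : ContDiff ℝ (⊤ : ℕ∞) H) (hm : ∀ t, ∀ x ∈ M, H (t, x) ∈ M) (h0 : ∀ x, H (0, x) = x)
    (h1 : ∀ x, H (1, x) = φ.toFun x) {k : ℕ} {ω : Form M k} (hω : IsExtDeriv ω 0) :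
    φ.pullback k ω - ω ∈ exactForms (allForms M) k := by
  refine sub_mem_exactForms_of_homotopy ρ ρ isOpen_univ (subset_univ _) hH.contDiffOn hm hω
    (fun x => ?_) fun x => ?_
  · refine (ρ.pull_eq_self x ?_ (fun y _ => h0 y) ω).symm
    simp only [h0]
    exact differentiableAt_id
  · rw [ρ.pullback_apply]
    simp only [h1]

theorem contDiff_exp_mul_I (s : ℝ) :
    ContDiff ℝ (⊤ : ℕ∞) fun p : ℝ × C4 => Complex.exp ((s * p.1 : ℝ) * Complex.I) :=
  contDiff_cexp.comp ((Complex.ofRealCLM.contDiff.comp (contDiff_const.mul contDiff_fst)).mul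
    contDiff_const)

theorem contDiff_coord_snd (j : Fin 4) : ContDiff ℝ (⊤ : ℕ∞) (fun p : ℝ × C4 => p.2 j) :=
  (contDiff_coord j).comp contDiff_snd

theorem exp_arg_mul_I {p : ℂ} (hp : ‖p‖ = 1) : Complex.exp ((p.arg : ℝ) * Complex.I) = p := by
  have := Complex.norm_mul_exp_arg_mul_I p
  rwa [hp, Complex.ofReal_one, one_mul] at this

/-- The rotation of `(z_1, z_2)` is isotopic to the identity. -/
theorem rotate_pullback_sub_mem_exactForms {r : ℕ} (hr : 1 ≤ r) {p : ℂ} (hp : ‖p‖ = 1)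
    (φ : SmoothMap (Wtilde r 1) (Wtilde r 1)) (hφ : φ.toFun = rotate p 1) {k : ℕ}
    {ω : Form (Wtilde r 1) k} (hω : IsExtDeriv ω 0) :
    φ.pullback k ω - ω ∈ exactForms (allForms (Wtilde r 1)) k := by
  have he := contDiff_exp_mul_I p.arg
  have hre : ContDiff ℝ (⊤ : ℕ∞) fun q : ℝ × C4 =>
      ((Complex.exp ((p.arg * q.1 : ℝ) * Complex.I)).re : ℂ) :=
    Complex.ofRealCLM.contDiff.comp (Complex.reCLM.contDiff.comp he)
  have him : ContDiff ℝ (⊤ : ℕ∞) fun q : ℝ × C4 =>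
      ((Complex.exp ((p.arg * q.1 : ℝ) * Complex.I)).im : ℂ) :=
    Complex.ofRealCLM.contDiff.comp (Complex.imCLM.contDiff.comp he)
  refine pullback_sub_mem_exactForms (nbhdRetraction r hr) φ
    (H := fun q => rotate (Complex.exp ((p.arg * q.1 : ℝ) * Complex.I)) 1 q.2) ?_ ?_ ?_ ?_ hω
  · rw [contDiff_pi]
    intro i
    fin_cases i
    · exact (hre.mul (contDiff_coord_snd 0)).sub (him.mul (contDiff_coord_snd 1))
    · exact (him.mul (contDiff_coord_snd 0)).add (hre.mul (contDiff_coord_snd 1))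
    · exact contDiff_const.mul (contDiff_coord_snd 2)
    · exact contDiff_coord_snd 3
  · exact fun t x hx => rotate_mem (Complex.norm_exp_ofReal_mul_I _) (one_pow r) hx
  · intro x
    funext i
    fin_cases i <;> simp [rotate]
  · intro x
    rw [hφ]
    simp only [mul_one, exp_arg_mul_I hp]

theorem cover_smul_mem {r : ℕ} {z w : C4} (hz : z ∈ Wtilde r 1) {s : ℂ} (hs : ‖s‖ = 1)
    (h : cover r w = s • cover r z) : w ∈ Wtilde r 1 := by
  rw [mem_Wtilde_iff] at hz ⊢
  rw [h, quadric_smul, totalNormSq_smul, hz.1, hz.2, hs]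
  simp

/-- A deck transformation of the branched cover is isotopic to the identity. -/
theorem deck_pullback_sub_mem_exactForms {r : ℕ} (hr : 1 ≤ r) {q : ℂ} (hq : q ^ r = 1)
    (φ : SmoothMap (Wtilde r 1) (Wtilde r 1)) (hφ : φ.toFun = rotate 1 q) {k : ℕ}
    {ω : Form (Wtilde r 1) k} (hω : IsExtDeriv ω 0) :
    φ.pullback k ω - ω ∈ exactForms (allForms (Wtilde r 1)) k := by
  have hq1 : ‖q‖ = 1 := Complex.norm_eq_one_of_pow_eq_one hq (by omega)
  have hpow (t : ℝ) : Complex.exp ((q.arg * t : ℝ) * Complex.I) ^ r =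
      Complex.exp ((r * q.arg * t : ℝ) * Complex.I) := by
    rw [← Complex.exp_nat_mul]
    push_cast
    ring_nf
  have h1 := contDiff_exp_mul_I q.arg
  have h2 := contDiff_exp_mul_I (r * q.arg)
  -- Weighted circle action: it lifts scalar multiplication by `exp (i r t arg q)` on the base, and
  -- at `t = 1` this scalar is `q ^ r = 1`, leaving only `z₃ ↦ q z₃`.
  refine pullback_sub_mem_exactForms (nbhdRetraction r hr) φ
    (H := fun p => ![Complex.exp ((r * q.arg * p.1 : ℝ) * Complex.I) * p.2 0,
      Complex.exp ((r * q.arg * p.1 : ℝ) * Complex.I) * p.2 1,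
      Complex.exp ((q.arg * p.1 : ℝ) * Complex.I) * p.2 2,
      Complex.exp ((r * q.arg * p.1 : ℝ) * Complex.I) * p.2 3]) ?_ ?_ ?_ ?_ hω
  · rw [contDiff_pi]
    intro i
    fin_cases i
    · exact h2.mul (contDiff_coord_snd 0)
    · exact h2.mul (contDiff_coord_snd 1)
    · exact h1.mul (contDiff_coord_snd 2)
    · exact h2.mul (contDiff_coord_snd 3)
  · intro t x hx
    refine cover_smul_mem hx (Complex.norm_exp_ofReal_mul_I (r * q.arg * t)) ?_
    funext i
    fin_cases i
    · rfl
    · rfl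
    · change (Complex.exp ((q.arg * t : ℝ) * Complex.I) * x 2) ^ r = _ * x 2 ^ r
      rw [mul_pow, hpow]
    · rfl
  · intro x
    funext i
    fin_cases i <;> simp
  · intro x
    have h3 : Complex.exp ((r * q.arg * 1 : ℝ) * Complex.I) = 1 := by
      rw [← hpow, mul_one, exp_arg_mul_I hq1, hq]
    have h4 : Complex.exp ((q.arg * 1 : ℝ) * Complex.I) = q := by
      rw [mul_one, exp_arg_mul_I hq1]
    rw [hφ, h3, h4]
    funext i
    fin_cases i <;> simp [rotate]

/-! ### Collapsing a neighbourhood of the branch locus -/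

/-- A smooth homotopy from the constant `1` to a function which vanishes near `0`. -/
def damping (t : ℝ) (w : ℂ) : ℝ :=
  1 - Real.smoothTransition t * (1 - Real.smoothTransition (4 * ‖w‖ ^ 2 - 1))

theorem damping_nonneg (t : ℝ) (w : ℂ) : 0 ≤ damping t w := by
  have h1 := Real.smoothTransition.nonneg t
  have h2 := Real.smoothTransition.le_one t
  have h3 := Real.smoothTransition.nonneg (4 * ‖w‖ ^ 2 - 1)
  have h4 := Real.smoothTransition.le_one (4 * ‖w‖ ^ 2 - 1)
  unfold damping
  nlinarith

theorem damping_le_one (t : ℝ) (w : ℂ) : damping t w ≤ 1 := by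
  have h1 := Real.smoothTransition.nonneg t
  have h4 := Real.smoothTransition.le_one (4 * ‖w‖ ^ 2 - 1)
  unfold damping
  nlinarith

theorem damping_zero (w : ℂ) : damping 0 w = 1 := by
  simp [damping, Real.smoothTransition.zero]

/-- The argument `4 ‖w‖² - 1` of the cut-off runs through `[0, 1]` as `‖w‖²` runs from `1/4` to
`1/2`. -/
theorem damping_one_eq_zero {w : ℂ} (hw : ‖w‖ ^ 2 < 1 / 4) : damping 1 w = 0 := by
  rw [damping, Real.smoothTransition.one, Real.smoothTransition.zero_of_nonpos (by linarith)]
  norm_num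

theorem damping_eq_one (t : ℝ) {w : ℂ} (hw : 1 / 2 < ‖w‖ ^ 2) : damping t w = 1 := by
  rw [damping, Real.smoothTransition.one_of_one_le (x := 4 * ‖w‖ ^ 2 - 1) (by linarith)]
  norm_num

theorem contDiff_damping : ContDiff ℝ (⊤ : ℕ∞) fun p : ℝ × ℂ => damping p.1 p.2 := by
  unfold damping
  refine contDiff_const.sub ((Real.smoothTransition.contDiff.comp contDiff_fst).mul
    (contDiff_const.sub (Real.smoothTransition.contDiff.comp ?_)))
  exact (contDiff_const.mul (contDiff_snd.norm_sq ℝ)).sub contDiff_const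

/-- The points of `ℂ⁴` whose third coordinate can be damped without leaving the domain of the
retraction. -/
def dampable : Set C4 :=
  {c | ‖quadric c‖ < partialNormSq c ∧
    (‖partialQuadric c‖ < partialNormSq c ∨ 1 / 2 < ‖c 2‖ ^ 2)}

theorem isOpen_dampable : IsOpen dampable :=
  isOpen_nearQuadric.inter ((isOpen_lt contDiff_partialQuadric.continuous.norm
    contDiff_partialNormSq.continuous).union
      (isOpen_lt continuous_const ((contDiff_coord 2).continuous.norm.pow 2)))

theorem mem_dampable_of_mem {r : ℕ} {z : C4} (hz : z ∈ Wtilde r 1) : cover r z ∈ dampable := by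
  refine ⟨mem_nearQuadric_of_mem hz, ?_⟩
  obtain ⟨h1, h2⟩ := mem_Wtilde_iff.1 hz
  by_cases h : 1 / 2 < ‖cover r z 2‖ ^ 2
  · exact Or.inr h
  -- Here `|P| = ‖c₃‖² ≤ 1/2`, whereas `N = 2 - ‖c₃‖² ≥ 3/2`.
  · left
    have h3 : ‖cover r z 2‖ ^ 2 = ‖partialQuadric (cover r z)‖ := by
      rw [← norm_pow, ← norm_neg, ← eq_neg_of_add_eq_zero_left h1]
    rw [totalNormSq] at h2
    linarith

/-- Multiplying the third coordinate by a real number with square `l ∈ [0, 1]` changes the quadric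
into the convex combination `(1 - l) P + l Q`, and both ends have norm below `N`. Where `|P| < N` is
not available the damping is trivial. -/
theorem damped_mem_nearQuadric {c d : C4} (hc : c ∈ dampable) (h0 : d 0 = c 0) (h1 : d 1 = c 1)
    (h3 : d 3 = c 3) {t : ℝ} {n : ℕ} (h2 : d 2 = (damping t (c 2) : ℂ) ^ n * c 2) :
    d ∈ nearQuadric := by
  have hp : partialQuadric d = partialQuadric c := by simp [partialQuadric, h0, h1, h3]
  have hn : partialNormSq d = partialNormSq c := by simp [partialNormSq, h0, h1, h3]
  change ‖partialQuadric d + d 2 ^ 2‖ < partialNormSq d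
  rw [hp, hn, h2]
  obtain ⟨hq, h | h⟩ := hc
  · set l : ℝ := (damping t (c 2) ^ n) ^ 2
    have hl0 : 0 ≤ l := sq_nonneg _
    have hl1 : l ≤ 1 := pow_le_one₀ (pow_nonneg (damping_nonneg _ _) _)
      (pow_le_one₀ (damping_nonneg _ _) (damping_le_one _ _))
    have he : partialQuadric c + ((damping t (c 2) : ℂ) ^ n * c 2) ^ 2 =
        ((1 - l : ℝ) : ℂ) * partialQuadric c + (l : ℂ) * quadric c := by
      simp only [l, quadric]
      push_cast
      ring
    rw [he]
    refine (norm_add_le _ _).trans_lt ?_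
    rw [norm_mul, norm_mul, Complex.norm_real, Complex.norm_real,
      Real.norm_of_nonneg (by linarith), Real.norm_of_nonneg hl0]
    rcases hl0.eq_or_lt with h0 | h0
    · rw [← h0]
      simpa using h
    · nlinarith [mul_lt_mul_of_pos_left hq h0, mul_le_mul_of_nonneg_left h.le (sub_nonneg.2 hl1)]
  · rw [damping_eq_one t h]
    simpa [quadric] using hq

/-- The damping of the third coordinate. -/
def damp (r m : ℕ) (p : ℝ × C4) : C4 :=
  ![p.2 0, p.2 1, (damping p.1 (p.2 2 ^ r) : ℂ) ^ m * p.2 2, p.2 3]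

theorem contDiff_damp (r m : ℕ) : ContDiff ℝ (⊤ : ℕ∞) (damp r m) := by
  rw [contDiff_pi]
  intro i
  fin_cases i
  · exact contDiff_coord_snd 0
  · exact contDiff_coord_snd 1
  · refine ContDiff.mul (ContDiff.pow ?_ m) (contDiff_coord_snd 2)
    exact Complex.ofRealCLM.contDiff.comp
      (contDiff_damping.comp (contDiff_fst.prodMk ((contDiff_coord_snd 2).pow r)))
  · exact contDiff_coord_snd 3

/-- The homotopy from the identity of `W̃_{r,1}` to a map which collapses a neighbourhood of the
branch locus to the branch locus. -/
def collapse (r m : ℕ) (p : ℝ × C4) : C4 := retract r (damp r m p)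

theorem cover_damp_mem {r m : ℕ} {p : ℝ × C4} (hp : cover r p.2 ∈ dampable) :
    cover r (damp r m p) ∈ nearQuadric := by
  refine damped_mem_nearQuadric (t := p.1) (n := m * r) hp rfl rfl rfl ?_
  change ((damping p.1 (p.2 2 ^ r) : ℂ) ^ m * p.2 2) ^ r = _ * p.2 2 ^ r
  rw [mul_pow, pow_mul]
  rfl

theorem contDiffOn_collapse (r m : ℕ) :
    ContDiffOn ℝ (⊤ : ℕ∞) (collapse r m) (univ ×ˢ (cover r ⁻¹' dampable)) :=
  (contDiffOn_retract r).comp (contDiff_damp r m).contDiffOn fun _ hp => cover_damp_mem hp.2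

theorem collapse_mem {r : ℕ} (hr : 1 ≤ r) (m : ℕ) {p : ℝ × C4} (hp : cover r p.2 ∈ dampable) :
    collapse r m p ∈ Wtilde r 1 := retract_mem hr (cover_damp_mem hp)

theorem collapse_zero {r m : ℕ} {z : C4} (hz : z ∈ Wtilde r 1) : collapse r m (0, z) = z := by
  have h : damp r m (0, z) = z := by
    funext i
    fin_cases i <;> simp [damp, damping_zero]
  rw [collapse, h, retract_eq_self hz]

theorem isSmoothAt_collapse {r : ℕ} (hr : 1 ≤ r) (m : ℕ) (t : ℝ) {z : C4}
    (hz : z ∈ Wtilde r 1) :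
    IsSmoothAt (Wtilde r 1) (Wtilde r 1) (fun y => collapse r m (t, y)) z :=
  ⟨cover r ⁻¹' dampable, isOpen_dampable.preimage (contDiff_cover r).continuous,
    mem_dampable_of_mem hz, (contDiffOn_collapse r m).comp
      (contDiff_prodMk_right t).contDiffOn fun _ h => ⟨trivial, h⟩,
    fun _ h => collapse_mem hr m h.2⟩

/-- The pullback along the collapsing map is cohomologous to the identity. -/
theorem collapse_sub_mem_exactForms {r : ℕ} (hr : 1 ≤ r) (m : ℕ) {k : ℕ}
    {ω τ : Form (Wtilde r 1) k} (hω : IsExtDeriv ω 0)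
    (hτ : ∀ x : Wtilde r 1, τ.1 x =
      (nbhdRetraction r hr).pull (Wtilde r 1) (fun y => collapse r m (1, y)) ω x) :
    τ - ω ∈ exactForms (allForms (Wtilde r 1)) k := by
  refine sub_mem_exactForms_of_homotopy (nbhdRetraction r hr) (nbhdRetraction r hr)
    (isOpen_dampable.preimage (contDiff_cover r).continuous) (fun z hz => mem_dampable_of_mem hz)
    (contDiffOn_collapse r m) (fun t z hz => collapse_mem hr m (mem_dampable_of_mem hz)) hω
    (fun x => ?_) hτ
  exact ((nbhdRetraction r hr).pull_eq_self x (isSmoothAt_collapse hr m 0 x.2).differentiableAt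
    (fun y hy => collapse_zero hy) ω).symm

/-! ### Local branches of the multivalued inverse of the branched cover -/

/-- The branch of the `r`-th root of `w` which equals `κ` at `w = κ ^ r`. -/
def branch (r : ℕ) (κ w : ℂ) : ℂ := κ * Complex.exp (Complex.log (w / κ ^ r) / r)

theorem branch_pow {r : ℕ} (hr : 1 ≤ r) {κ w : ℂ} (hκ : κ ≠ 0) (hw : w ≠ 0) :
    branch r κ w ^ r = w := by
  have hr0 : (r : ℂ) ≠ 0 := by
    exact_mod_cast (by omega : r ≠ 0)
  rw [branch, mul_pow, ← Complex.exp_nat_mul, mul_div_cancel₀ _ hr0,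
    Complex.exp_log (div_ne_zero hw (pow_ne_zero r hκ)), mul_div_cancel₀ _ (pow_ne_zero r hκ)]

theorem contDiffAt_branch {r : ℕ} {κ w : ℂ} (hw : w / κ ^ r ∈ Complex.slitPlane) :
    ContDiffAt ℝ (⊤ : ℕ∞) (branch r κ) w := by
  refine contDiffAt_const.mul (contDiff_cexp.contDiffAt.comp w (ContDiffAt.div_const ?_ _))
  exact (contDiffAt_clog hw).comp w (contDiffAt_id.div_const _)

/-- The lift of a point of the base, damped near the branch locus, to the ambient space of the
cover. -/
def dampedLift (r : ℕ) (κ : ℂ) (c : C4) : C4 :=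
  ![c 0, c 1, (damping 1 (c 2) : ℂ) * branch r κ (c 2), c 3]

/-- A local branch of the composite of the inverse of the cover and the collapsing map. -/
def branchMap (r : ℕ) (κ : ℂ) (c : C4) : C4 := retract r (dampedLift r κ c)

/-- The domain of `branchMap`. -/
def branchDomain (r : ℕ) (κ : ℂ) : Set C4 :=
  dampable ∩ ({c | ‖c 2‖ ^ 2 < 1 / 4} ∪ {c | κ ≠ 0 ∧ c 2 / κ ^ r ∈ Complex.slitPlane})

theorem isOpen_branchDomain (r : ℕ) (κ : ℂ) : IsOpen (branchDomain r κ) := by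
  refine isOpen_dampable.inter (IsOpen.union ?_ (IsOpen.and isOpen_const ?_))
  · exact isOpen_lt ((contDiff_coord 2).continuous.norm.pow 2) continuous_const
  · exact Complex.isOpen_slitPlane.preimage ((contDiff_coord 2).continuous.div_const _)

/-- The value `κ = 0` occurs only on the branch locus, where the first alternative holds and the
choice of root is irrelevant. -/
theorem mem_branchDomain {r : ℕ} {κ : ℂ} {c : C4} (hc : c ∈ dampable) (hκ : κ ^ r = c 2)
    (hr : 1 ≤ r) : c ∈ branchDomain r κ := by
  refine ⟨hc, ?_⟩
  by_cases h : c 2 = 0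
  · left
    simp [h]
  · right
    have hκ0 : κ ≠ 0 := by
      rintro rfl
      rw [zero_pow (by omega)] at hκ
      exact h hκ.symm
    refine ⟨hκ0, ?_⟩
    rw [hκ, div_self h]
    exact Complex.one_mem_slitPlane

theorem dampedLift_two_pow {r : ℕ} (hr : 1 ≤ r) {κ : ℂ} {c : C4} (hc : c ∈ branchDomain r κ) :
    ((damping 1 (c 2) : ℂ) * branch r κ (c 2)) ^ r = (damping 1 (c 2) : ℂ) ^ r * c 2 := by
  rcases hc.2 with h | h
  · rw [damping_one_eq_zero h]
    simp [show r ≠ 0 by omega]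
  · have h2 : c 2 ≠ 0 := by
      intro h0
      have := h.2
      rw [h0, zero_div] at this
      exact Complex.zero_notMem_slitPlane this
    rw [mul_pow, branch_pow hr h.1 h2]

/-- Damping a root once amounts to damping its `r`-th power `r` times; this is the purpose of the
exponent `m` in `damp`. -/
theorem cover_dampedLift {r : ℕ} (hr : 1 ≤ r) {κ : ℂ} {c : C4} (hc : c ∈ branchDomain r κ) :
    cover r (dampedLift r κ c) = damp 1 r (1, c) := by
  have h := dampedLift_two_pow hr hc
  funext i
  fin_cases i
  · rfl
  · rfl
  · simpa [cover, dampedLift, damp] using h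
  · rfl

theorem cover_one (c : C4) : cover 1 c = c := by
  funext i
  fin_cases i <;> simp [cover]

theorem cover_dampedLift_mem {r : ℕ} (hr : 1 ≤ r) {κ : ℂ} {c : C4}
    (hc : c ∈ branchDomain r κ) : cover r (dampedLift r κ c) ∈ nearQuadric := by
  rw [cover_dampedLift hr hc, ← cover_one (damp 1 r (1, c))]
  refine cover_damp_mem ?_
  rw [cover_one]
  exact hc.1

theorem contDiffOn_dampedLift (r : ℕ) (κ : ℂ) :
    ContDiffOn ℝ (⊤ : ℕ∞) (dampedLift r κ) (branchDomain r κ) := by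
  rw [contDiffOn_pi]
  intro i
  fin_cases i
  · exact (contDiff_coord 0).contDiffOn
  · exact (contDiff_coord 1).contDiffOn
  · intro c hc
    refine ContDiffAt.contDiffWithinAt ?_
    rcases hc.2 with h | h
    -- Near the branch locus the damped coordinate is identically zero, whatever the branch does
    -- there.
    · refine contDiffAt_const (c := (0 : ℂ)) |>.congr_of_eventuallyEq ?_
      filter_upwards [(isOpen_lt ((contDiff_coord 2).continuous.norm.pow 2)
        continuous_const).mem_nhds h] with y hy
      change (damping 1 (y 2) : ℂ) * branch r κ (y 2) = 0
      rw [damping_one_eq_zero hy]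
      simp
    · refine ContDiffAt.mul ?_ ?_
      · exact (Complex.ofRealCLM.contDiff.comp (contDiff_damping.comp
          (contDiff_const.prodMk (contDiff_coord 2)))).contDiffAt
      · exact ContDiffAt.comp (g := branch r κ) (f := fun y : C4 => y 2) c (contDiffAt_branch h.2)
          (contDiff_coord 2).contDiffAt
  · exact (contDiff_coord 3).contDiffOn

theorem isSmoothAt_branchMap {r : ℕ} (hr : 1 ≤ r) {κ : ℂ} {c : C4} {S : Set C4}
    (hc : c ∈ branchDomain r κ) : IsSmoothAt S (Wtilde r 1) (branchMap r κ) c :=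
  ⟨branchDomain r κ, isOpen_branchDomain r κ, hc,
    (contDiffOn_retract r).comp (contDiffOn_dampedLift r κ) fun _ h => cover_dampedLift_mem hr h,
    fun _ h => retract_mem hr (cover_dampedLift_mem hr h.2)⟩

theorem cover_retract_eq {r : ℕ} (hr : 1 ≤ r) (z : C4) :
    cover r (retract r z) = retract 1 (cover r z) := by
  have h := cover_retract le_rfl (z := cover r z)
  rw [cover_one, cover_one] at h
  rw [cover_retract hr, h]

theorem cover_branchMap {r : ℕ} (hr : 1 ≤ r) {κ : ℂ} {c : C4} (hc : c ∈ branchDomain r κ) :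
    cover r (branchMap r κ c) = collapse 1 r (1, c) := by
  rw [branchMap, cover_retract_eq hr, cover_dampedLift hr hc, collapse]

theorem rotate_one (q : ℂ) (z : C4) : rotate 1 q z = ![z 0, z 1, q * z 2, z 3] := by
  simp [rotate]

theorem cover_rotate_one {r : ℕ} {q : ℂ} (hq : q ^ r = 1) (z : C4) :
    cover r (rotate 1 q z) = cover r z := by
  rw [rotate_one]
  funext i
  fin_cases i <;> simp [cover, mul_pow, hq]

theorem retract_rotate_one {r : ℕ} {q : ℂ} (hq : q ^ r = 1) (z : C4) :
    retract r (rotate 1 q z) = rotate 1 q (retract r z) := by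
  rw [retract, cover_rotate_one hq, rotate_one, rotate_one]
  funext i
  fin_cases i
  · rfl
  · rfl
  · exact mul_left_comm _ _ _
  · rfl

/-- The quotient `f / g` is continuous at `x` and nearby takes values in the finite set of `r`-th
roots of unity, so it is constant near `x`. -/
theorem eventually_eq_root_mul {X : Type*} [TopologicalSpace X] {f g : X → ℂ} {x : X} {r : ℕ}
    (hr : 1 ≤ r) (hf : ContinuousAt f x) (hg : ContinuousAt g x) (hgx : g x ≠ 0)
    (h : ∀ᶠ y in 𝓝 x, f y ^ r = g y ^ r) :
    ∃ q : ℂ, q ^ r = 1 ∧ ∀ᶠ y in 𝓝 x, f y = q * g y := by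
  have hq : ∀ᶠ y in 𝓝 x, (f y / g y) ^ r = 1 := by
    filter_upwards [h, hg.eventually_ne hgx] with y hy hy0
    rw [div_pow, hy, div_self (pow_ne_zero r hy0)]
  refine ⟨f x / g x, hq.self_of_nhds, ?_⟩
  have hfin : {q : ℂ | q ^ r = 1}.Finite := by
    have := (Polynomial.nthRoots r (1 : ℂ)).toFinset.finite_toSet
    refine this.subset fun q hq => ?_
    simpa [Polynomial.mem_nthRoots (show 0 < r by omega)] using hq
  have hcl : IsClosed ({q : ℂ | q ^ r = 1} \ {f x / g x}) := (hfin.subset sdiff_subset).isClosed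
  have hn : ∀ᶠ y in 𝓝 x, f y / g y ∈ ({q : ℂ | q ^ r = 1} \ {f x / g x})ᶜ :=
    (hf.div hg hgx).eventually_mem (hcl.isOpen_compl.mem_nhds fun h => h.2 rfl)
  filter_upwards [hq, hn, hg.eventually_ne hgx] with y h1 h2 h3
  have h4 : f y / g y = f x / g x := by
    by_contra h5
    exact h2 ⟨h1, h5⟩
  rw [← h4, div_mul_cancel₀ _ h3]

/-- Away from the branch locus two branches of the root differ by a constant root of unity; close to
it both are damped to zero. The retraction commutes with deck transformations. -/
theorem branchMap_eventuallyEq {r : ℕ} (hr : 1 ≤ r) {κ κ' : ℂ} {c : C4}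
    (hc : c ∈ branchDomain r κ) (hc' : c ∈ branchDomain r κ') :
    ∃ q : ℂ, q ^ r = 1 ∧ branchMap r κ' =ᶠ[𝓝 c] fun y => rotate 1 q (branchMap r κ y) := by
  have key {q : ℂ} (hq : q ^ r = 1) {y : C4}
      (h : (damping 1 (y 2) : ℂ) * branch r κ' (y 2) =
        q * ((damping 1 (y 2) : ℂ) * branch r κ (y 2))) :
      branchMap r κ' y = rotate 1 q (branchMap r κ y) := by
    rw [branchMap, branchMap, ← retract_rotate_one hq, rotate_one]
    congr 1
    funext i
    fin_cases i
    · rfl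
    · rfl
    · exact h
    · rfl
  by_cases hs : ‖c 2‖ ^ 2 < 1 / 4
  · refine ⟨1, one_pow r, ?_⟩
    filter_upwards [(isOpen_lt ((contDiff_coord 2).continuous.norm.pow 2)
        continuous_const).mem_nhds hs] with y hy
    refine key (one_pow r) ?_
    rw [damping_one_eq_zero hy]
    simp
  · have h := hc.2.resolve_left hs
    have h' := hc'.2.resolve_left hs
    have h2 : c 2 ≠ 0 := by
      intro h0
      rw [h0] at hs
      norm_num at hs
    have hcont {κ : ℂ} (h : c 2 / κ ^ r ∈ Complex.slitPlane) :
        ContinuousAt (fun y : C4 => branch r κ (y 2)) c :=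
      (contDiffAt_branch h).continuousAt.comp (f := fun y : C4 => y 2)
        (contDiff_coord 2).continuous.continuousAt
    have hne : branch r κ (c 2) ≠ 0 := by
      intro h0
      have := branch_pow hr h.1 h2
      rw [h0, zero_pow (by omega)] at this
      exact h2 this.symm
    obtain ⟨q, hq, he⟩ := eventually_eq_root_mul hr (hcont h'.2) (hcont h.2) hne (by
      filter_upwards [(contDiff_coord 2).continuous.continuousAt.eventually_ne h2] with y hy
      rw [branch_pow hr h.1 hy, branch_pow hr h'.1 hy])
    refine ⟨q, hq, ?_⟩
    filter_upwards [he] with y hy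
    refine key hq ?_
    rw [hy]
    ring

/-- The coordinate `z₃` is itself a root of `z₃ ^ r`, so any branch recovers it up to a deck
transformation. Damping it once gives `collapse r 1`. -/
theorem branchMap_cover_eventuallyEq {r : ℕ} (hr : 1 ≤ r) {κ : ℂ} {z : C4}
    (hc : cover r z ∈ branchDomain r κ) :
    ∃ q : ℂ, q ^ r = 1 ∧
      (fun y => branchMap r κ (cover r y)) =ᶠ[𝓝 z] fun y => rotate 1 q (collapse r 1 (1, y)) := by
  have key {q : ℂ} (hq : q ^ r = 1) {y : C4}
      (h : (damping 1 (y 2 ^ r) : ℂ) * branch r κ (y 2 ^ r) =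
        q * ((damping 1 (y 2 ^ r) : ℂ) ^ 1 * y 2)) :
      branchMap r κ (cover r y) = rotate 1 q (collapse r 1 (1, y)) := by
    rw [branchMap, collapse, ← retract_rotate_one hq, rotate_one]
    congr 1
    funext i
    fin_cases i
    · rfl
    · rfl
    · exact h
    · rfl
  have hcc : Continuous fun y : C4 => y 2 ^ r := (contDiff_coord 2).continuous.pow r
  by_cases hs : ‖z 2 ^ r‖ ^ 2 < 1 / 4
  · refine ⟨1, one_pow r, ?_⟩
    filter_upwards [(isOpen_lt (hcc.norm.pow 2) continuous_const).mem_nhds hs] with y hy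
    refine key (one_pow r) ?_
    rw [damping_one_eq_zero hy]
    simp
  · have h : κ ≠ 0 ∧ z 2 ^ r / κ ^ r ∈ Complex.slitPlane := hc.2.resolve_left hs
    have h2 : z 2 ≠ 0 := by
      intro h0
      rw [h0, zero_pow (by omega)] at hs
      norm_num at hs
    obtain ⟨q, hq, he⟩ := eventually_eq_root_mul hr (f := fun y : C4 => branch r κ (y 2 ^ r))
      (g := fun y : C4 => y 2) (x := z)
      ((contDiffAt_branch h.2).continuousAt.comp (f := fun y : C4 => y 2 ^ r)
        hcc.continuousAt) (contDiff_coord 2).continuous.continuousAt h2 (by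
      filter_upwards [(contDiff_coord 2).continuous.continuousAt.eventually_ne h2] with y hy
      rw [branch_pow hr h.1 (pow_ne_zero r hy)])
    refine ⟨q, hq, ?_⟩
    filter_upwards [he] with y hy
    refine key hq ?_
    rw [hy]
    ring

/-! ### Transfer of forms to the base -/

/-- A deck transformation of the branched cover. -/
def deck (r : ℕ) (ζ : Mu r) : SmoothMap (Wtilde r 1) (Wtilde r 1) where
  toFun := rotate 1 (ζ : ℂˣ).val
  contDiff := contDiff_rotate _ _
  mapsTo := fun _ hz => rotate_mem norm_one (val_pow_eq_one ζ) hz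

theorem exists_deck {r : ℕ} (hr : 1 ≤ r) {q : ℂ} (hq : q ^ r = 1) :
    ∃ ζ : Mu r, (deck r ζ).toFun = rotate 1 q := by
  have : NeZero r := ⟨by omega⟩
  exact ⟨rootsOfUnity.mkOfPowEq q hq, rfl⟩

theorem pull_rotate_comp {r : ℕ} (hr : 1 ≤ r) {k : ℕ} {ω : Form (Wtilde r 1) k}
    (hω : ω ∈ invariantForms (deck r) k) {M : Set C4} {f g : C4 → C4} {x : C4} (hx : x ∈ M)
    (hf : IsSmoothAt M (Wtilde r 1) f x) (hg : IsSmoothAt M (Wtilde r 1) g x) {q : ℂ}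
    (hq : q ^ r = 1) (h : g =ᶠ[𝓝 x] fun y => rotate 1 q (f y)) :
    (nbhdRetraction r hr).pull M g ω x = (nbhdRetraction r hr).pull M f ω x := by
  obtain ⟨ζ, hζ⟩ := exists_deck hr hq
  have h1 := (nbhdRetraction r hr).pull_pullback (nbhdRetraction r hr) hx hf (deck r ζ) ω
  rw [hω ζ] at h1
  rw [h1]
  refine (nbhdRetraction r hr).pull_congr hx hg.differentiableAt
    ((deck r ζ).comp_isSmoothAt hf).differentiableAt ?_ ω
  rw [hζ]
  exact h.filter_mono nhdsWithin_le_nhds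

/-- An `r`-th root. -/
def someRoot (r : ℕ) (hr : 1 ≤ r) (w : ℂ) : ℂ :=
  (IsAlgClosed.exists_pow_nat_eq w (show 0 < r by omega)).choose

theorem someRoot_pow (r : ℕ) (hr : 1 ≤ r) (w : ℂ) : someRoot r hr w ^ r = w :=
  (IsAlgClosed.exists_pow_nat_eq w (show 0 < r by omega)).choose_spec

/-- `τ` is the transfer of the form `ω` to the base. -/
def IsTransfer (r : ℕ) (hr : 1 ≤ r) {k : ℕ} (ω : Form (Wtilde r 1) k)
    (τ : Form (Wtilde 1 1) k) : Prop :=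
  ∀ x : Wtilde 1 1, τ.1 x = (nbhdRetraction r hr).pull (Wtilde 1 1)
    (branchMap r (someRoot r hr ((x : C4) 2))) ω x

variable {r : ℕ} (hr : 1 ≤ r)

theorem mem_branchDomain_someRoot (x : Wtilde 1 1) :
    (x : C4) ∈ branchDomain r (someRoot r hr ((x : C4) 2)) := by
  refine mem_branchDomain ?_ (someRoot_pow r hr _) hr
  rw [← cover_one (x : C4)]
  exact mem_dampable_of_mem x.2

theorem isSmoothAt_transfer (x : Wtilde 1 1) :
    IsSmoothAt (Wtilde 1 1) (Wtilde r 1) (branchMap r (someRoot r hr ((x : C4) 2))) x :=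
  isSmoothAt_branchMap hr (mem_branchDomain_someRoot hr x)

theorem pull_branchMap_eq {k : ℕ} {ω : Form (Wtilde r 1) k}
    (hω : ω ∈ invariantForms (deck r) k) (x y : Wtilde 1 1)
    (hy : (y : C4) ∈ branchDomain r (someRoot r hr ((x : C4) 2))) :
    (nbhdRetraction r hr).pull (Wtilde 1 1) (branchMap r (someRoot r hr ((y : C4) 2))) ω y =
      (nbhdRetraction r hr).pull (Wtilde 1 1) (branchMap r (someRoot r hr ((x : C4) 2))) ω y := by
  obtain ⟨q, hq, he⟩ := branchMap_eventuallyEq hr hy (mem_branchDomain_someRoot hr y)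
  exact pull_rotate_comp hr hω y.2 (isSmoothAt_branchMap hr hy) (isSmoothAt_transfer hr y) hq he

/-- The chosen roots need not vary continuously: changing the root changes the branch by a deck
transformation, which an invariant form does not see. -/
theorem exists_isTransfer {k : ℕ} {ω : Form (Wtilde r 1) k}
    (hω : ω ∈ invariantForms (deck r) k) : ∃ τ, IsTransfer r hr ω τ :=
  (nbhdRetraction r hr).exists_form_of_pull ω _ (isSmoothAt_transfer hr) fun x =>
    ⟨_, isOpen_branchDomain _ _, mem_branchDomain_someRoot hr x, pull_branchMap_eq hr hω x⟩

theorem IsTransfer.isExtDeriv {k : ℕ} {ω : Form (Wtilde r 1) k}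
    (hω : ω ∈ invariantForms (deck r) k) {η : Form (Wtilde r 1) (k + 1)} {τ : Form (Wtilde 1 1) k}
    {θ : Form (Wtilde 1 1) (k + 1)} (hτ : IsTransfer r hr ω τ) (hθ : IsTransfer r hr η θ)
    (h : IsExtDeriv ω η) : IsExtDeriv τ θ := by
  refine (nbhdRetraction r hr).isExtDeriv_of_pull h (isSmoothAt_transfer hr) (fun x => ?_) hθ
  exact ⟨_, isOpen_branchDomain _ _, mem_branchDomain_someRoot hr x, fun y hy => by
    rw [hτ y, pull_branchMap_eq hr hω x y hy]⟩

theorem isTransfer_zero (k : ℕ) : IsTransfer r hr (0 : Form (Wtilde r 1) k) 0 := fun x =>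
  ((nbhdRetraction r hr).pull_zero x.2 (isSmoothAt_transfer hr x) k).symm

/-- Up to deck transformations, `branchMap ∘ cover` is the collapsing map of the cover, which is
homotopic to the identity. -/
theorem IsTransfer.pullback_sub_mem_exactForms {k : ℕ} {ω : Form (Wtilde r 1) k}
    (hω : ω ∈ invariantForms (deck r) k) (hc : IsExtDeriv ω 0) {τ : Form (Wtilde 1 1) k}
    (hτ : IsTransfer r hr ω τ) :
    (branchedCover r 1).pullback k τ - ω ∈ exactForms (allForms (Wtilde r 1)) k := by
  refine collapse_sub_mem_exactForms hr 1 hc fun z => ?_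
  have hx := mem_branchDomain_someRoot hr ((branchedCover r 1).apply z)
  have hs := isSmoothAt_transfer hr ((branchedCover r 1).apply z)
  rw [(nbhdRetraction r hr).pullback_apply_of_pull (branchedCover r 1) hs
    (hτ ((branchedCover r 1).apply z))]
  obtain ⟨q, hq, he⟩ := branchMap_cover_eventuallyEq hr hx
  exact pull_rotate_comp hr hω z.2 (isSmoothAt_collapse hr 1 1 z.2)
    (IsSmoothAt.comp_smoothMap hs) hq he

/-- Here the composite is `cover ∘ branchMap`, the collapsing map of the base with exponent `r`. -/
theorem IsTransfer.sub_mem_exactForms {k : ℕ} {τ : Form (Wtilde 1 1) k} (hc : IsExtDeriv τ 0)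
    {θ : Form (Wtilde 1 1) k} (hθ : IsTransfer r hr ((branchedCover r 1).pullback k τ) θ) :
    θ - τ ∈ exactForms (allForms (Wtilde 1 1)) k := by
  refine collapse_sub_mem_exactForms le_rfl r hc fun x => ?_
  have hs := isSmoothAt_transfer hr x
  rw [hθ x, (nbhdRetraction r hr).pull_pullback (nbhdRetraction 1 le_rfl) x.2 hs]
  refine (nbhdRetraction 1 le_rfl).pull_congr x.2
    ((branchedCover r 1).comp_isSmoothAt hs).differentiableAt
    (isSmoothAt_collapse le_rfl r 1 x.2).differentiableAt ?_ τ
  refine Filter.Eventually.filter_mono nhdsWithin_le_nhds ?_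
  filter_upwards [(isOpen_branchDomain _ _).mem_nhds (mem_branchDomain_someRoot hr x)] with y hy
  exact cover_branchMap hr hy

end Conifold
end

/-! ### The isomorphisms in cohomology. -/

noncomputable section

open Set Filter Topology DeRham

namespace Conifold

/-! ### The branched cover -/

theorem rotate_rotate (p q p' q' : ℂ) (z : C4) :
    rotate p q (rotate p' q' z) = rotate (p * p') (q * q') z := by
  funext i
  fin_cases i <;> simp [rotate] <;> ring

theorem eqOn_deck (r : ℕ) (ζ ζ' : Mu r) :
    EqOn ((deck r ζ').comp (deck r ζ)).toFun (deck r (ζ' * ζ)).toFun (Wtilde r 1) := by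
  intro z _
  change rotate 1 _ (rotate 1 _ z) = rotate 1 _ z
  rw [rotate_rotate]
  simp

theorem eqOn_actTilde (r : ℕ) (hr : 1 ≤ r) (a : ℤ) (ζ ζ' : Mu r) :
    EqOn ((actTilde r hr a 1 ζ').comp (actTilde r hr a 1 ζ)).toFun
      (actTilde r hr a 1 (ζ' * ζ)).toFun (Wtilde r 1) := by
  intro z _
  change rotate _ _ (rotate _ _ z) = rotate _ _ z
  rw [rotate_rotate, mul_zpow]
  simp

theorem eqOn_actBase (r : ℕ) (hr : 1 ≤ r) (a : ℤ) (ζ ζ' : Mu r) :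
    EqOn ((actBase r hr a 1 ζ').comp (actBase r hr a 1 ζ)).toFun
      (actBase r hr a 1 (ζ' * ζ)).toFun (Wtilde 1 1) := by
  intro z _
  change rotate _ _ (rotate _ _ z) = rotate _ _ z
  rw [rotate_rotate, mul_zpow]
  simp

theorem isExtDeriv_of_mem_closedForms {E : Type*} [NormedAddCommGroup E] [NormedSpace ℝ E]
    {M : Set E} {S : ∀ k, Submodule ℝ (Form M k)} {k : ℕ} {ω : Form M k}
    (h : ω ∈ closedForms S k) : IsExtDeriv ω 0 := h.2

variable (r : ℕ) (hr : 1 ≤ r) (a : ℤ)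

theorem branchedCover_pullback_mem_deck {k : ℕ} (τ : Form (Wtilde 1 1) k) :
    (branchedCover r 1).pullback k τ ∈ invariantForms (deck r) k := by
  intro ζ
  rw [← SmoothMap.pullback_comp]
  have h : EqOn ((branchedCover r 1).comp (deck r ζ)).toFun (branchedCover r 1).toFun (Wtilde r 1) :=
    fun z _ => cover_rotate_one (val_pow_eq_one ζ) z
  rw [SmoothMap.pullback_congr h]

include hr in
/-- A closed form on the base is exact if its pullback is exact. -/
theorem mem_exactForms_of_branchedCover {k : ℕ} {τ : Form (Wtilde 1 1) k} (hc : IsExtDeriv τ 0)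
    (h : (branchedCover r 1).pullback k τ ∈ exactForms (allForms (Wtilde r 1)) k) :
    τ ∈ exactForms (allForms (Wtilde 1 1)) k := by
  have : NeZero r := ⟨by omega⟩
  have := Fintype.ofFinite (Mu r)
  -- The transfer of the pullback of `τ` is cohomologous to `τ`, so exactness of the transfer is
  -- enough.
  suffices h' : ∃ θ, IsTransfer r hr ((branchedCover r 1).pullback k τ) θ ∧
      θ ∈ exactForms (allForms (Wtilde 1 1)) k by
    obtain ⟨θ, hθ, hθe⟩ := h'
    have h2 := Submodule.sub_mem _ hθe (IsTransfer.sub_mem_exactForms hr hc hθ)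
    rwa [sub_sub_cancel] at h2
  cases k with
  | zero =>
    have h0 : (branchedCover r 1).pullback 0 τ = 0 := h
    rw [h0]
    exact ⟨0, isTransfer_zero hr 0, Submodule.zero_mem _⟩
  | succ k =>
    obtain ⟨θ, hθ⟩ := exists_isTransfer hr (branchedCover_pullback_mem_deck r τ)
    obtain ⟨⟨η, ω₁⟩, ⟨hd, -⟩, he⟩ := h
    have hd' : IsExtDeriv η ((branchedCover r 1).pullback (k + 1) τ) := by
      rw [← he]
      exact hd
    -- Only deck-invariant forms have a transfer, so the primitive is averaged first; its derivative
    -- is already invariant.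
    have hd2 := average_isExtDeriv (deck r) hd'
    rw [average_eq_self (branchedCover_pullback_mem_deck r τ)] at hd2
    have hinv := average_mem_invariantForms (eqOn_deck r) η
    obtain ⟨θ', hθ'⟩ := exists_isTransfer hr hinv
    exact ⟨θ, hθ, ⟨(θ', θ), ⟨IsTransfer.isExtDeriv hr hinv hθ' hθ hd2, trivial⟩, rfl⟩⟩

include hr in
/-- Every closed form on the cover is cohomologous to the pullback of a closed form on the base. -/
theorem exists_branchedCover_pullback_sub_mem_exactForms {k : ℕ} {ω : Form (Wtilde r 1) k}
    (hc : IsExtDeriv ω 0) : ∃ τ : Form (Wtilde 1 1) k, IsExtDeriv τ 0 ∧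
      (branchedCover r 1).pullback k τ - ω ∈ exactForms (allForms (Wtilde r 1)) k := by
  have : NeZero r := ⟨by omega⟩
  have := Fintype.ofFinite (Mu r)
  have hinv := average_mem_invariantForms (eqOn_deck r) ω
  have hc' := average_isClosed (deck r) hc
  obtain ⟨τ, hτ⟩ := exists_isTransfer hr hinv
  refine ⟨τ, IsTransfer.isExtDeriv hr hinv hτ (isTransfer_zero hr _) hc', ?_⟩
  have h1 := IsTransfer.pullback_sub_mem_exactForms hr hinv hc' hτ
  have h2 := average_sub_mem_exactForms (deck r) (ω := ω) fun ζ =>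
    deck_pullback_sub_mem_exactForms hr (val_pow_eq_one ζ) (deck r ζ) rfl hc
  have h3 := Submodule.add_mem _ h1 h2
  rwa [sub_add_sub_cancel] at h3

theorem average_branchedCover_pullback [Fintype (Mu r)] {k : ℕ} (τ : Form (Wtilde 1 1) k) :
    (branchedCover r 1).pullback k (average (actBase r hr a 1) k τ) =
      average (actTilde r hr a 1) k ((branchedCover r 1).pullback k τ) := by
  rw [average_apply, average_apply, map_smul, map_sum]
  simp only [← SmoothMap.pullback_comp, branchedCover_equivariant]

/-- The statement for all forms descends to `μ_r`-invariant ones: primitives and preimages are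
averaged over the finite group, and equivariance lets averaging pass through the pullback. -/
theorem branchedCoverCohomology_bijective (k : ℕ) :
    Function.Bijective (branchedCoverCohomology r hr a k) := by
  have : NeZero r := ⟨by omega⟩
  have := Fintype.ofFinite (Mu r)
  refine SmoothMap.cohomologyMap_bijective _ _ (fun τ hτ h => ?_) fun ω hω => ?_
  · exact mem_exactForms_invariantForms (eqOn_actBase r hr a) hτ.1
      (mem_exactForms_of_branchedCover r hr (isExtDeriv_of_mem_closedForms hτ)
        (exactForms_le_allForms _ _ h))
  · obtain ⟨τ, hτ, h⟩ := exists_branchedCover_pullback_sub_mem_exactForms r hr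
      (isExtDeriv_of_mem_closedForms hω)
    have hinv : average (actBase r hr a 1) k τ ∈ invBase r hr a k :=
      average_mem_invariantForms (eqOn_actBase r hr a) τ
    refine ⟨average (actBase r hr a 1) k τ, ⟨hinv, average_isClosed _ hτ⟩, ?_⟩
    refine mem_exactForms_invariantForms (eqOn_actTilde r hr a)
      (Submodule.sub_mem _ (branchedCover_pullback_mem r hr a k _ hinv) hω.1) ?_
    have h1 := average_mem_exactForms (actTilde r hr a 1) h
    rwa [map_sub, average_eq_self (ω := ω) hω.1, ← average_branchedCover_pullback] at h1

/-! ### The Stiefel manifold `W_{1,1}` is diffeomorphic to `S³ × S²` -/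

theorem mem_Wtilde_one_iff {z : C4} : z ∈ Wtilde 1 1 ↔
    (z 0).re ^ 2 + (z 1).re ^ 2 + (z 2).re ^ 2 + (z 3).re ^ 2 = 1 ∧
    (z 0).im ^ 2 + (z 1).im ^ 2 + (z 2).im ^ 2 + (z 3).im ^ 2 = 1 ∧
    (z 0).re * (z 0).im + (z 1).re * (z 1).im + (z 2).re * (z 2).im +
      (z 3).re * (z 3).im = 0 := by
  simp [Wtilde]

theorem mem_sphereProduct_iff {p : EuclideanSpace ℝ (Fin 4) × EuclideanSpace ℝ (Fin 3)} :
    p ∈ sphereProduct ↔ p.1 0 ^ 2 + p.1 1 ^ 2 + p.1 2 ^ 2 + p.1 3 ^ 2 = 1 ∧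
      p.2 0 ^ 2 + p.2 1 ^ 2 + p.2 2 ^ 2 = 1 := by
  have h {n : ℕ} (x : EuclideanSpace ℝ (Fin n)) : ‖x‖ = 1 ↔ ∑ i, x i ^ 2 = 1 := by
    rw [← EuclideanSpace.real_norm_sq_eq]
    exact (pow_eq_one_iff_of_nonneg (norm_nonneg x) two_ne_zero).symm
  rw [sphereProduct, mem_prod, mem_sphere_zero_iff_norm, mem_sphere_zero_iff_norm, h, h,
    Fin.sum_univ_four, Fin.sum_univ_three]

/-- The trivialization `(x, u) ↦ x + i x u` of the Stiefel manifold by quaternion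
multiplication. -/
def fromSpheres : SmoothMap sphereProduct (Wtilde 1 1) where
  toFun p :=
    ![⟨p.1 0, -p.1 1 * p.2 0 - p.1 2 * p.2 1 - p.1 3 * p.2 2⟩,
      ⟨p.1 1, p.1 0 * p.2 0 + p.1 2 * p.2 2 - p.1 3 * p.2 1⟩,
      ⟨p.1 2, p.1 0 * p.2 1 - p.1 1 * p.2 2 + p.1 3 * p.2 0⟩,
      ⟨p.1 3, p.1 0 * p.2 2 + p.1 1 * p.2 1 - p.1 2 * p.2 0⟩]
  contDiff := by
    have h (x y : EuclideanSpace ℝ (Fin 4) × EuclideanSpace ℝ (Fin 3) → ℝ)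
        (hx : ContDiff ℝ (⊤ : ℕ∞) x) (hy : ContDiff ℝ (⊤ : ℕ∞) y) :
        ContDiff ℝ (⊤ : ℕ∞) fun p => (⟨x p, y p⟩ : ℂ) :=
      Complex.equivRealProdCLM.symm.contDiff.comp (hx.prodMk hy)
    rw [contDiff_pi]
    intro i
    fin_cases i <;> exact h _ _ (by fun_prop) (by fun_prop)
  mapsTo p hp := by
    obtain ⟨h1, h2⟩ := mem_sphereProduct_iff.1 hp
    rw [mem_Wtilde_one_iff]
    simp only [Matrix.cons_val_zero, Matrix.cons_val_one, Matrix.cons_val]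
    refine ⟨h1, ?_, by ring⟩
    linear_combination (p.2 0 ^ 2 + p.2 1 ^ 2 + p.2 2 ^ 2) * h1 + h2

/-- The inverse `x + i y ↦ (x, x̄ y)` of the trivialization. -/
def toSpheres : SmoothMap (Wtilde 1 1) sphereProduct where
  toFun z :=
    (!₂[(z 0).re, (z 1).re, (z 2).re, (z 3).re],
      !₂[(z 0).re * (z 1).im - (z 1).re * (z 0).im - (z 2).re * (z 3).im + (z 3).re * (z 2).im,
        (z 0).re * (z 2).im + (z 1).re * (z 3).im - (z 2).re * (z 0).im - (z 3).re * (z 1).im,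
        (z 0).re * (z 3).im - (z 1).re * (z 2).im + (z 2).re * (z 1).im - (z 3).re * (z 0).im])
  contDiff := by
    have hre (j : Fin 4) : ContDiff ℝ (⊤ : ℕ∞) fun z : C4 => (z j).re :=
      Complex.reCLM.contDiff.comp (contDiff_coord j)
    have him (j : Fin 4) : ContDiff ℝ (⊤ : ℕ∞) fun z : C4 => (z j).im :=
      Complex.imCLM.contDiff.comp (contDiff_coord j)
    refine ContDiff.prodMk ?_ ?_
    · rw [contDiff_euclidean]
      intro i
      fin_cases i <;> exact hre _
    · rw [contDiff_euclidean]
      intro i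
      fin_cases i
      · exact ((((hre 0).mul (him 1)).sub ((hre 1).mul (him 0))).sub ((hre 2).mul (him 3))).add
          ((hre 3).mul (him 2))
      · exact ((((hre 0).mul (him 2)).add ((hre 1).mul (him 3))).sub ((hre 2).mul (him 0))).sub
          ((hre 3).mul (him 1))
      · exact ((((hre 0).mul (him 3)).sub ((hre 1).mul (him 2))).add ((hre 2).mul (him 1))).sub
          ((hre 3).mul (him 0))
  mapsTo z hz := by
    obtain ⟨h1, h2, h3⟩ := mem_Wtilde_one_iff.1 hz
    rw [mem_sphereProduct_iff]
    simp only [Matrix.cons_val_zero, Matrix.cons_val_one, Matrix.cons_val]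
    refine ⟨h1, ?_⟩
    -- Quaternion norms multiply, so `|x̄ y|² = |x|² |y|² = 1`; the real part of `x̄ y` is `⟨x, y⟩ =
    -- 0`, leaving an imaginary unit.
    linear_combination ((z 0).im ^ 2 + (z 1).im ^ 2 + (z 2).im ^ 2 + (z 3).im ^ 2) * h1 + h2 -
      ((z 0).re * (z 0).im + (z 1).re * (z 1).im + (z 2).re * (z 2).im +
        (z 3).re * (z 3).im) * h3

theorem fromSpheres_toSpheres : ∀ z ∈ Wtilde 1 1, (fromSpheres.comp toSpheres).toFun z = z := by
  intro z hz
  obtain ⟨h1, -, h3⟩ := mem_Wtilde_one_iff.1 hz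
  change fromSpheres.toFun (toSpheres.toFun z) = z
  funext i
  fin_cases i <;> apply Complex.ext <;>
    simp only [fromSpheres, toSpheres, Matrix.cons_val_zero, Matrix.cons_val_one,
      Matrix.cons_val, Fin.zero_eta, Fin.mk_one, Fin.reduceFinMk]
  · linear_combination (z 0).im * h1 - (z 0).re * h3
  · linear_combination (z 1).im * h1 - (z 1).re * h3
  · linear_combination (z 2).im * h1 - (z 2).re * h3
  · linear_combination (z 3).im * h1 - (z 3).re * h3

theorem toSpheres_fromSpheres :
    ∀ p ∈ sphereProduct, (toSpheres.comp fromSpheres).toFun p = p := by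
  intro p hp
  obtain ⟨h1, -⟩ := mem_sphereProduct_iff.1 hp
  change toSpheres.toFun (fromSpheres.toFun p) = p
  refine Prod.ext ?_ ?_
  · ext i
    fin_cases i <;> rfl
  · ext i
    fin_cases i <;>
      simp only [fromSpheres, toSpheres, Matrix.cons_val_zero,
        Matrix.cons_val_one, Matrix.cons_val, Fin.zero_eta, Fin.mk_one, Fin.reduceFinMk]
    · linear_combination p.2 0 * h1
    · linear_combination p.2 1 * h1
    · linear_combination p.2 2 * h1

/-- The diffeomorphism handles all forms. Passing to invariant forms loses nothing, since each
rotation is isotopic to the identity and a closed form is therefore cohomologous to its average. -/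
theorem fromSpheres_cohomologyMap_bijective (k : ℕ) :
    Function.Bijective (fromSpheres.cohomologyMap (invBase r hr a) (allForms sphereProduct)
      (fun _ _ _ => trivial) k) := by
  have : NeZero r := ⟨by omega⟩
  have := Fintype.ofFinite (Mu r)
  refine SmoothMap.cohomologyMap_bijective _ _ (fun τ hτ h => ?_) fun ω hω => ?_
  · refine mem_exactForms_invariantForms (eqOn_actBase r hr a) hτ.1 ?_
    have h1 := toSpheres.pullback_mem_exactForms h
    rwa [← SmoothMap.pullback_comp, SmoothMap.pullback_eq_self fromSpheres_toSpheres] at h1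
  · have hc := toSpheres.pullback_isClosed (isExtDeriv_of_mem_closedForms hω)
    refine ⟨average (actBase r hr a 1) k (toSpheres.pullback k ω),
      ⟨average_mem_invariantForms (eqOn_actBase r hr a) _, average_isClosed _ hc⟩, ?_⟩
    have h1 := average_sub_mem_exactForms (actBase r hr a 1) fun ζ =>
      rotate_pullback_sub_mem_exactForms le_rfl (norm_zpow_eq_one hr a ζ) (actBase r hr a 1 ζ) rfl
        hc
    have h2 := fromSpheres.pullback_mem_exactForms h1
    rwa [map_sub, ← SmoothMap.pullback_comp,
      SmoothMap.pullback_eq_self toSpheres_fromSpheres] at h2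

end Conifold
end

theorem proposition3p2p1 (r : ℕ) (hr : 1 ≤ r) (a : ℤ) (ha : IsCoprime a (r : ℤ)) :
    (∀ k : ℕ, Function.Bijective (Conifold.branchedCoverCohomology r hr a k)) ∧
    (∀ k : ℕ, Nonempty (Conifold.linkCohomology r hr a k ≃ₗ[ℝ]
      DeRham.Cohomology (DeRham.allForms Conifold.sphereProduct) k)) := by
  refine ⟨Conifold.branchedCoverCohomology_bijective r hr a, fun k => ⟨?_⟩⟩
  exact (LinearEquiv.ofBijective _ (Conifold.branchedCoverCohomology_bijective r hr a k)).symm.trans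
    (LinearEquiv.ofBijective _ (Conifold.fromSpheres_cohomologyMap_bijective r hr a k))
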